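/- Let $\mathbb{X}$ be a countably infinite set with a hierarchical structure: a sequence of partitions $(\mathcal{P}_r)_{r\ge 0}$ of $\mathbb{X}$ (whose members are called clusters of rank $r$) and natural numbers $(n_r)_{r\ge 1}$ such that $\mathcal{P}_0$ is the partition into single points, every cluster of rank $r\ge 1$ is a union of $n_r$ distinct clusters of rank $r-1$, and any two points of $\mathbb{X}$ lie in a common cluster of some rank. Write $Q_r(x)$ for the cluster of rank $r$ containing $x$. Let $0<p_s<1$ for $s\ge 1$ with $\sum_{s=1}^\infty p_s=1$, let $(\mathbf{E}_s\psi)(x)=|Q_s(x)|^{-1}\sum_{y\in Q_s(x)}\psi(y)$ on $\ell^2(\mathbb{X})$, and let $\Delta=\sum_{s=1}^\infty p_s\mathbf{E}_s$. Let $\mathbb{P}_0$ be a Borel probability measure on $\mathbb{R}$ with $\operatorname{supp}\mathbb{P}_0\subseteq[v_-,v_+]$ for some $v_-,v_+\in\mathbb{R}$, let $\mathbb{P}=\bigotimes_{x\in\mathbb{X}}\mathbb{P}_0$ on $\Omega=\mathbb{R}^{\mathbb{X}}$ with expectation $\mathbb{E}$, and let $H^\omega=\Delta+V^\omega$ on $\ell^2(\mathbb{X})$,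 where $(V^\omega\psi)(x)=\omega_x\psi(x)$ (a bounded operator for $\mathbb{P}$-almost every $\omega$). Fix $x_0\in\mathbb{X}$, write $Q_\kappa=Q_\kappa(x_0)$, and let $N(E)=\mathbb{E}\big[\langle\delta_{x_0},\chi_{]-\infty,E]}(H^\omega)\,\delta_{x_0}\rangle\big]$, $E\in\mathbb{R}$. For $\kappa\ge 0$ define on $\ell^2(Q_\kappa)$ the Neumann and Dirichlet restrictions $$\Delta_{\mathrm{N},\kappa}=\sum_{s=1}^{\kappa}p_s\mathbf{E}_s\Big|_{\ell^2(Q_\kappa)},\qquad \Delta_{\mathrm{D},\kappa}=\Delta_{\mathrm{N},\kappa}+\sum_{s=\kappa+1}^\infty p_s\,\mathbb{1},$$ and, for $\mathrm{X}\in\{\mathrm{N},\mathrm{D}\}$, $H^\omega_{\mathrm{X},\kappa}=\Delta_{\mathrm{X},\kappa}+V^\omega$. Let $N^\omega_{\mathrm{X},\kappa}(E)$ be $|Q_\kappa|^{-1}$ times the number of eigenvalues of $H^\omega_{\mathrm{X},\kappa}$, counted with multiplicity, that are at most $E$. Then for each $\mathrm{X}\in\{\mathrm{N},\mathrm{D}\}$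 there is an event $\Omega_0\subseteq\Omega$ with $\mathbb{P}[\Omega_0]=1$ such that for every $\omega\in\Omega_0$ and every continuity point $E\in\mathbb{R}$ of $N$, $$\lim_{\kappa\to\infty}N^\omega_{\mathrm{X},\kappa}(E)=N(E).$$ -/

import Mathlib

noncomputable section

namespace HierarchicalAnderson

open MeasureTheory ProbabilityTheory
open scoped ENNReal CompactlySupported

/-- A hierarchical structure on `X`: a sequence of partitions of `X` (given by the equivalence
relations `rel r`, whose classes are the clusters of rank `r`) and natural numbers
`n 1, n 2, …` (the value `n 0` plays no role) such that
* the partition of rank `0` consists of the single elements,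
* every cluster of rank `r + 1` is the union of `n (r + 1)` distinct clusters of rank `r`,
* any two points lie in a common cluster of some rank. -/
structure HierarchicalStructure (X : Type*) where
  /-- the partition of rank `r` -/
  rel : ℕ → Setoid X
  /-- the number of clusters of rank `r - 1` in a cluster of rank `r ≥ 1` -/
  n : ℕ → ℕ
  rank_zero : rel 0 = ⊥
  cluster_eq_union : ∀ r : ℕ, ∀ C ∈ (rel (r + 1)).classes,
    ∃ S : Finset (Set X), (∀ D ∈ S, D ∈ (rel r).classes) ∧ S.card = n (r + 1) ∧
      C = ⋃ D ∈ S, D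
  exists_rel : ∀ x y : X, ∃ r : ℕ, (rel r) x y

/-- The Hilbert space `ℓ²(X)` of complex-valued square-summable functions on `X`. -/
abbrev L2 (X : Type*) : Type _ := lp (fun _ : X => ℂ) 2

namespace HierarchicalStructure

variable {X : Type*} (H : HierarchicalStructure X)

theorem finite_of_mem_classes (r : ℕ) : ∀ C ∈ (H.rel r).classes, C.Finite := by
  induction r with
  | zero =>
    rintro C ⟨y, rfl⟩
    rw [H.rank_zero]
    exact (Set.finite_singleton y).subset fun x hx => hx
  | succ r ih =>
    intro C hC
    obtain ⟨S, hS, -, rfl⟩ := H.cluster_eq_union r C hC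
    exact S.finite_toSet.biUnion fun D hD => ih D (hS D hD)

theorem cluster_finite (r : ℕ) (x : X) : {y : X | (H.rel r) y x}.Finite :=
  H.finite_of_mem_classes r _ ⟨x, rfl⟩

/-- `Q_r(x)`, the cluster of rank `r` that contains `x`. -/
def cluster (r : ℕ) (x : X) : Finset X := (H.cluster_finite r x).toFinset

theorem mem_cluster {r : ℕ} {x y : X} : y ∈ H.cluster r x ↔ (H.rel r) y x := by
  simp [cluster]

theorem self_mem_cluster (r : ℕ) (x : X) : x ∈ H.cluster r x :=
  H.mem_cluster.2 ((H.rel r).refl x)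

theorem mem_cluster_comm {r : ℕ} {x y : X} : y ∈ H.cluster r x ↔ x ∈ H.cluster r y := by
  rw [mem_cluster, mem_cluster]
  exact ⟨(H.rel r).symm, (H.rel r).symm⟩

theorem cluster_eq_of_mem {r : ℕ} {x y : X} (h : y ∈ H.cluster r x) :
    H.cluster r y = H.cluster r x := by
  rw [mem_cluster] at h
  ext z
  rw [mem_cluster, mem_cluster]
  exact ⟨fun hz => (H.rel r).trans hz h, fun hz => (H.rel r).trans hz ((H.rel r).symm h)⟩

theorem card_cluster_pos (r : ℕ) (x : X) : 0 < (H.cluster r x).card :=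
  Finset.card_pos.2 ⟨x, H.self_mem_cluster r x⟩

/-- The average of `ψ` over the cluster of rank `s` around `x`. -/
def avg (s : ℕ) (ψ : X → ℂ) (x : X) : ℂ :=
  ((H.cluster s x).card : ℂ)⁻¹ * ∑ y ∈ H.cluster s x, ψ y

theorem norm_avg_sq_le (s : ℕ) (ψ : X → ℂ) (x : X) :
    ‖H.avg s ψ x‖ ^ 2 ≤ ((H.cluster s x).card : ℝ)⁻¹ * ∑ y ∈ H.cluster s x, ‖ψ y‖ ^ 2 := by
  have hc : (0 : ℝ) < (H.cluster s x).card := by exact_mod_cast H.card_cluster_pos s x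
  have h1 : ‖∑ y ∈ H.cluster s x, ψ y‖ ^ 2 ≤
      (H.cluster s x).card * ∑ y ∈ H.cluster s x, ‖ψ y‖ ^ 2 :=
    (pow_le_pow_left₀ (norm_nonneg _) (norm_sum_le _ _) 2).trans sq_sum_le_card_mul_sum_sq
  rw [avg, norm_mul, mul_pow, norm_inv, Complex.norm_natCast]
  calc ((H.cluster s x).card : ℝ)⁻¹ ^ 2 * ‖∑ y ∈ H.cluster s x, ψ y‖ ^ 2
      ≤ ((H.cluster s x).card : ℝ)⁻¹ ^ 2 *
        ((H.cluster s x).card * ∑ y ∈ H.cluster s x, ‖ψ y‖ ^ 2) := by gcongr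
    _ = _ := by field_simp

theorem sum_norm_avg_sq_le (s : ℕ) (ψ : L2 X) (F : Finset X) :
    ∑ x ∈ F, ‖H.avg s ψ x‖ ^ 2 ≤ ‖ψ‖ ^ 2 := by
  classical
  set T : Finset X := F.biUnion (H.cluster s) with hT
  have hTsat : ∀ x ∈ T, H.cluster s x ⊆ T := by
    intro x hx
    obtain ⟨z, hz, hxz⟩ := Finset.mem_biUnion.1 hx
    rw [H.cluster_eq_of_mem hxz]
    exact Finset.subset_biUnion_of_mem (H.cluster s) hz
  have hFT : F ⊆ T := fun x hx => Finset.mem_biUnion.2 ⟨x, hx, H.self_mem_cluster s x⟩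
  calc ∑ x ∈ F, ‖H.avg s ψ x‖ ^ 2
      ≤ ∑ x ∈ T, ‖H.avg s ψ x‖ ^ 2 :=
        Finset.sum_le_sum_of_subset_of_nonneg hFT fun _ _ _ => by positivity
    _ ≤ ∑ x ∈ T, ((H.cluster s x).card : ℝ)⁻¹ * ∑ y ∈ H.cluster s x, ‖ψ y‖ ^ 2 :=
        Finset.sum_le_sum fun x _ => H.norm_avg_sq_le s ψ x
    _ = ∑ x ∈ T, ∑ y ∈ H.cluster s x, ((H.cluster s y).card : ℝ)⁻¹ * ‖ψ y‖ ^ 2 := by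
        refine Finset.sum_congr rfl fun x _ => ?_
        rw [Finset.mul_sum]
        exact Finset.sum_congr rfl fun y hy => by rw [H.cluster_eq_of_mem hy]
    _ = ∑ y ∈ T, ∑ x ∈ H.cluster s y, ((H.cluster s y).card : ℝ)⁻¹ * ‖ψ y‖ ^ 2 := by
        refine Finset.sum_comm' fun x y => ?_
        constructor
        · rintro ⟨hx, hy⟩
          exact ⟨H.mem_cluster_comm.1 hy, hTsat x hx hy⟩
        · rintro ⟨hx, hy⟩
          exact ⟨hTsat y hy hx, H.mem_cluster_comm.1 hx⟩
    _ = ∑ y ∈ T, ‖ψ y‖ ^ 2 := by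
        refine Finset.sum_congr rfl fun y _ => ?_
        have hc : ((H.cluster s y).card : ℝ) ≠ 0 := by exact_mod_cast (H.card_cluster_pos s y).ne'
        rw [Finset.sum_const, nsmul_eq_mul, mul_inv_cancel_left₀ hc]
    _ ≤ ‖ψ‖ ^ 2 := by
        have h := lp.sum_rpow_le_norm_rpow (p := 2) (by norm_num) ψ T
        simpa using h

/-- The cluster averaging operator `E_s` on `ℓ²(X)`:
`(E_s ψ)(x) = |Q_s(x)|⁻¹ ∑_{y ∈ Q_s(x)} ψ(y)`. -/
def averaging (s : ℕ) : L2 X →L[ℂ] L2 X :=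
  LinearMap.mkContinuous
    { toFun := fun ψ => ⟨H.avg s ψ, memℓp_gen' (C := ‖ψ‖ ^ 2) fun F => by
        simpa using H.sum_norm_avg_sq_le s ψ F⟩
      map_add' := fun ψ φ => by
        ext x
        change H.avg s (fun y => ψ y + φ y) x = H.avg s ψ x + H.avg s φ x
        simp only [avg, Finset.sum_add_distrib, mul_add]
      map_smul' := fun c ψ => by
        ext x
        simp only [avg, lp.coeFn_smul, Pi.smul_apply, smul_eq_mul, RingHom.id_apply,
          ← Finset.mul_sum]
        ring }
    1 fun ψ => by
      rw [one_mul]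
      refine lp.norm_le_of_forall_sum_le (by norm_num) (norm_nonneg _) fun F => ?_
      simpa using H.sum_norm_avg_sq_le s ψ F

theorem averaging_apply (s : ℕ) (ψ : L2 X) (x : X) :
    H.averaging s ψ x = ((H.cluster s x).card : ℂ)⁻¹ * ∑ y ∈ H.cluster s x, ψ y := rfl

/-- The hierarchical Laplacian `Δ = ∑_{s ≥ 1} p_s E_s` (the series converges in operator norm when
`p` is summable). -/
def laplacian (p : ℕ → ℝ) : L2 X →L[ℂ] L2 X :=
  ∑' s : ℕ, (p (s + 1) : ℂ) • H.averaging (s + 1)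

end HierarchicalStructure

section Potential

variable {X : Type*}

theorem sum_norm_mul_sq_le (ω : X → ℝ) (C : ℝ) (hC : ∀ x, |ω x| ≤ C) (ψ : L2 X) (F : Finset X) :
    ∑ x ∈ F, ‖(ω x : ℂ) * ψ x‖ ^ 2 ≤ (|C| * ‖ψ‖) ^ 2 := by
  have h := lp.sum_rpow_le_norm_rpow (p := 2) (by norm_num) ψ F
  have h' : ∑ x ∈ F, ‖ψ x‖ ^ 2 ≤ ‖ψ‖ ^ 2 := by simpa using h
  calc ∑ x ∈ F, ‖(ω x : ℂ) * ψ x‖ ^ 2 ≤ ∑ x ∈ F, |C| ^ 2 * ‖ψ x‖ ^ 2 := by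
        refine Finset.sum_le_sum fun x _ => ?_
        rw [norm_mul, mul_pow, Complex.norm_real, Real.norm_eq_abs]
        have := (hC x).trans (le_abs_self C)
        gcongr
    _ = |C| ^ 2 * ∑ x ∈ F, ‖ψ x‖ ^ 2 := by rw [Finset.mul_sum]
    _ ≤ |C| ^ 2 * ‖ψ‖ ^ 2 := by gcongr
    _ = (|C| * ‖ψ‖) ^ 2 := by ring

/-- Multiplication by a bounded function `ω` on `ℓ²(X)`. -/
def boundedPotential (ω : X → ℝ) (C : ℝ) (hC : ∀ x, |ω x| ≤ C) : L2 X →L[ℂ] L2 X :=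
  LinearMap.mkContinuous
    { toFun := fun ψ => ⟨fun x => (ω x : ℂ) * ψ x,
        memℓp_gen' (C := (|C| * ‖ψ‖) ^ 2) fun F => by
          simpa using sum_norm_mul_sq_le ω C hC ψ F⟩
      map_add' := fun ψ φ => by
        ext x
        change (ω x : ℂ) * (ψ x + φ x) = (ω x : ℂ) * ψ x + (ω x : ℂ) * φ x
        ring
      map_smul' := fun c ψ => by
        ext x
        change (ω x : ℂ) * (c * ψ x) = c * ((ω x : ℂ) * ψ x)
        ring }
    |C| fun ψ => by
      refine lp.norm_le_of_forall_sum_le (by norm_num) (by positivity) fun F => ?_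
      simpa using sum_norm_mul_sq_le ω C hC ψ F

open Classical in
/-- The potential `V^ω`, `(V^ω ψ)(x) = ω_x ψ(x)`, for bounded `ω`. Unbounded configurations, on
which `V^ω` is not a bounded operator, get the value `0`; they form a null set when the
single-site distribution has compact support. -/
def potential (ω : X → ℝ) : L2 X →L[ℂ] L2 X :=
  if h : ∃ C : ℝ, ∀ x, |ω x| ≤ C then boundedPotential ω h.choose h.choose_spec else 0

theorem potential_apply (ω : X → ℝ) (h : ∃ C : ℝ, ∀ x, |ω x| ≤ C) (ψ : L2 X) (x : X) :
    potential ω ψ x = (ω x : ℂ) * ψ x := by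
  rw [potential, dif_pos h]
  rfl

end Potential

section Spectral

variable {E : Type*} [NormedAddCommGroup E] [InnerProductSpace ℂ E] [CompleteSpace E]

/-- The positive functional `φ ↦ ⟨ψ, φ(T) ψ⟩` on `C_c(ℝ)`, for a bounded self-adjoint `T`. -/
def spectralFunctional (T : E →L[ℂ] E) (ψ : E) : C_c(ℝ, ℝ) →ₚ[ℝ] ℝ :=
  PositiveLinearMap.mk₀
    { toFun := fun φ => (inner ℂ ψ (cfc (φ : ℝ → ℝ) T ψ)).re
      map_add' := fun φ χ => by
        have h : cfc (⇑(φ + χ)) T = cfc (⇑φ) T + cfc (⇑χ) T :=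
          cfc_add (a := T) (⇑φ) (⇑χ) φ.continuous.continuousOn χ.continuous.continuousOn
        rw [h, add_apply, inner_add_right, Complex.add_re]
      map_smul' := fun c φ => by
        have h : cfc (⇑(c • φ)) T = c • cfc (⇑φ) T :=
          cfc_smul c (⇑φ) T φ.continuous.continuousOn
        rw [h, smul_apply, ← Complex.coe_smul, inner_smul_right]
        simp }
    fun φ hφ => by
      have h : 0 ≤ cfc (⇑φ) T := cfc_nonneg fun x _ => hφ x
      exact ((ContinuousLinearMap.nonneg_iff_isPositive _).1 h).re_inner_nonneg_right ψ

/-- The spectral measure `B ↦ ⟨ψ, χ_B(T) ψ⟩` of a bounded self-adjoint operator `T` at the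
vector `ψ`: the Borel measure on `ℝ` that represents `φ ↦ ⟨ψ, φ(T) ψ⟩`. -/
def spectralMeasure (T : E →L[ℂ] E) (ψ : E) : Measure ℝ :=
  RealRMK.rieszMeasure (spectralFunctional T ψ)

theorem integral_spectralMeasure (T : E →L[ℂ] E) (ψ : E) (φ : C_c(ℝ, ℝ)) :
    ∫ t, φ t ∂(spectralMeasure T ψ) = (inner ℂ ψ (cfc (φ : ℝ → ℝ) T ψ)).re :=
  RealRMK.integral_rieszMeasure (spectralFunctional T ψ) φ

end Spectral

section Model

variable {X : Type*} (H : HierarchicalStructure X) (p : ℕ → ℝ)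

/-- The hierarchical Anderson Hamiltonian `H^ω = Δ + V^ω` on `ℓ²(X)`. -/
def hamiltonian (ω : X → ℝ) : L2 X →L[ℂ] L2 X := H.laplacian p + potential ω

/-- The probability measure `ℙ = ⨂_{x ∈ X} ℙ₀` on `Ω = ℝ^X`. -/
def law (X : Type*) (P₀ : Measure ℝ) [IsProbabilityMeasure P₀] : Measure (X → ℝ) :=
  Measure.infinitePi fun _ : X => P₀

open Classical in
/-- The integrated density of states `N(E) = 𝔼[⟨δ_{x₀}, χ_{]-∞, E]}(H^ω) δ_{x₀}⟩]`. -/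
def ids (P₀ : Measure ℝ) [IsProbabilityMeasure P₀] (x₀ : X) (E : ℝ) : ℝ :=
  ∫ ω, (spectralMeasure (hamiltonian H p ω) (lp.single 2 x₀ (1 : ℂ))).real (Set.Iic E) ∂(law X P₀)

/-- The two kinds of finite-volume restrictions. -/
inductive Restriction
  | neumann
  | dirichlet

open Classical in
/-- The matrix of the restriction of `E_s` to `ℓ²(Q_κ(x₀))`, for `s ≤ κ`. -/
def averagingMatrix (x₀ : X) (κ s : ℕ) : Matrix (H.cluster κ x₀) (H.cluster κ x₀) ℂ :=
  Matrix.of fun x y => if (y : X) ∈ H.cluster s x then ((H.cluster s (x : X)).card : ℂ)⁻¹ else 0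

open Classical in
/-- The Neumann restriction `Δ_N = ∑_{s=1}^κ p_s E_s` on `ℓ²(Q_κ(x₀))` and the Dirichlet
restriction `Δ_D = Δ_N + (∑_{s > κ} p_s) 𝟙`. -/
def laplacianMatrix (x₀ : X) (κ : ℕ) :
    Restriction → Matrix (H.cluster κ x₀) (H.cluster κ x₀) ℂ
  | .neumann => ∑ s ∈ Finset.Icc 1 κ, (p s : ℂ) • averagingMatrix H x₀ κ s
  | .dirichlet => ∑ s ∈ Finset.Icc 1 κ, (p s : ℂ) • averagingMatrix H x₀ κ s +
      Matrix.scalar _ ((∑' s : ℕ, p (κ + 1 + s) : ℝ) : ℂ)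

open Classical in
/-- The finite-volume Hamiltonian `H^ω_{X,κ} = Δ_{X,κ} + V^ω` on `ℓ²(Q_κ(x₀))`. -/
def hamiltonianMatrix (x₀ : X) (κ : ℕ) (b : Restriction) (ω : X → ℝ) :
    Matrix (H.cluster κ x₀) (H.cluster κ x₀) ℂ :=
  laplacianMatrix H p x₀ κ b + Matrix.diagonal fun x : H.cluster κ x₀ => (ω x : ℂ)

theorem isHermitian_averagingMatrix (x₀ : X) (κ s : ℕ) :
    (averagingMatrix H x₀ κ s).IsHermitian := by
  ext x y
  simp only [Matrix.conjTranspose_apply, averagingMatrix, Matrix.of_apply]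
  by_cases h : (x : X) ∈ H.cluster s y
  · rw [if_pos h, if_pos (H.mem_cluster_comm.1 h), H.cluster_eq_of_mem h]
    simp
  · rw [if_neg h, if_neg fun h' => h (H.mem_cluster_comm.1 h')]
    simp

open Classical in
theorem isHermitian_laplacianMatrix (x₀ : X) (κ : ℕ) (b : Restriction) :
    (laplacianMatrix H p x₀ κ b).IsHermitian := by
  have h : (∑ s ∈ Finset.Icc 1 κ, (p s : ℂ) • averagingMatrix H x₀ κ s).IsHermitian := by
    simp only [Matrix.IsHermitian, Matrix.conjTranspose_sum, Matrix.conjTranspose_smul,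
      (isHermitian_averagingMatrix H x₀ κ _).eq]
    simp
  cases b with
  | neumann => exact h
  | dirichlet =>
    refine h.add ?_
    simp [Matrix.IsHermitian, Matrix.scalar_apply, Matrix.diagonal_conjTranspose, Pi.star_def]

open Classical in
theorem isHermitian_hamiltonianMatrix (x₀ : X) (κ : ℕ) (b : Restriction) (ω : X → ℝ) :
    (hamiltonianMatrix H p x₀ κ b ω).IsHermitian := by
  refine (isHermitian_laplacianMatrix H p x₀ κ b).add ?_
  simp [Matrix.IsHermitian, Matrix.diagonal_conjTranspose, Pi.star_def]

open Classical in
/-- The normalised eigenvalue counting function `N^ω_{X,κ}(E)`: the number of eigenvalues of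
`H^ω_{X,κ}`, with multiplicity, in `]-∞, E]`, divided by `|Q_κ|`. -/
def countingFunction (x₀ : X) (κ : ℕ) (b : Restriction) (ω : X → ℝ) (E : ℝ) : ℝ :=
  ((H.cluster κ x₀).card : ℝ)⁻¹ * ∑ j : H.cluster κ x₀,
    (Set.Iic E).indicator 1 ((isHermitian_hamiltonianMatrix H p x₀ κ b ω).eigenvalues j)

end Model

end HierarchicalAnderson

end

noncomputable section

namespace HierarchicalAnderson

open MeasureTheory ProbabilityTheory
open scoped ENNReal CompactlySupported

/-! ### Symmetry of the hierarchy and growth of its clusters. -/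

namespace HierarchicalStructure

variable {X : Type*} (H : HierarchicalStructure X)

/-! The proof is by the method of moments. The `k`-th moment of the finite-volume eigenvalue
distribution is a normalised trace, that is, an average over `Q_κ` of diagonal elements of the
`k`-th power of the matrix (`sum_eigenvalues_pow`). A cluster of rank at most `κ` that meets `Q_κ`
lies inside it, so these are exactly the diagonal elements for the operator truncated at rank `κ`.
The Dirichlet condition merely adds a constant to the potential.

Truncating further at a fixed rank `r` changes each diagonal element by at most a constant times
`∑_{s > r} p_s`, uniformly in `κ ≥ r` (`abs_diagMoment_shift_sub_le`). The operator truncated at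
rank `r` decouples the clusters of that rank. Its traces over disjoint clusters are independent, and
they are identically distributed because some permutation of `X` carries any point to any other and
preserves the clusters of ranks up to `r` (`exists_perm`). As `Q_κ` is a union of such clusters, the
strong law of large numbers gives the almost sure limit of the averages
(`ae_tendsto_average_diagMoment`). Letting `r → ∞` identifies the limit of the moments as the
expected moments of the spectral measure at `δ_{x₀}` (`ae_tendsto_average_eigenvalues_pow`).

If the potential is bounded by `C`, all measures involved live on `[-(1 + C), 1 + C]`. The
Weierstrass theorem therefore upgrades moments to continuous test functions, and continuous ramps
squeeze the indicator of a half-line at continuity points (`tendsto_cdf_of_tendsto_moments`). -/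

theorem rel_succ {r : ℕ} {x y : X} (h : H.rel r x y) : H.rel (r + 1) x y := by
  obtain ⟨S, hS, -, hC⟩ := H.cluster_eq_union r {z | H.rel (r + 1) z y} ⟨y, rfl⟩
  have hy : y ∈ {z | H.rel (r + 1) z y} := (H.rel (r + 1)).refl y
  rw [hC] at hy
  obtain ⟨D, hD, hyD⟩ := Set.mem_iUnion₂.1 hy
  have hx : x ∈ {z | H.rel (r + 1) z y} := by
    rw [hC]
    refine Set.mem_iUnion₂.2 ⟨D, hD, ?_⟩
    obtain ⟨w, rfl⟩ := hS D hD
    exact (H.rel r).trans h hyD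
  exact hx

theorem rel_mono {r s : ℕ} (hrs : r ≤ s) {x y : X} (h : H.rel r x y) : H.rel s x y := by
  induction s, hrs using Nat.le_induction with
  | base => exact h
  | succ s _ ih => exact H.rel_succ ih

theorem cluster_mono {r s : ℕ} (hrs : r ≤ s) (x : X) : H.cluster r x ⊆ H.cluster s x :=
  fun _ hy => H.mem_cluster.2 (H.rel_mono hrs (H.mem_cluster.1 hy))

/-- Numbering the subclusters of one cluster supplies digits for an address of each point;
surjectivity onto all digits is what makes clusters of equal rank isomorphic. -/
theorem exists_label_class (r : ℕ) (q : Quotient (H.rel (r + 1))) :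
    ∃ g : X → Fin (H.n (r + 1)),
      (∀ y z, Quotient.mk _ y = q → Quotient.mk _ z = q → (g y = g z ↔ H.rel r y z)) ∧
      ∀ i, ∃ y, Quotient.mk _ y = q ∧ g y = i := by
  classical
  induction q using Quotient.inductionOn with | h x =>
  obtain ⟨S, hS, hcard, hC⟩ := H.cluster_eq_union r {z | H.rel (r + 1) z x} ⟨x, rfl⟩
  set cls : X → Set X := fun y => {z | H.rel r z y} with hcls
  have hmem : ∀ y, H.rel (r + 1) y x → cls y ∈ S := by
    intro y hy
    have hy' : y ∈ {z | H.rel (r + 1) z x} := hy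
    rw [hC] at hy'
    obtain ⟨D, hD, hyD⟩ := Set.mem_iUnion₂.1 hy'
    obtain ⟨w, rfl⟩ := hS D hD
    have : cls y = {z | H.rel r z w} := by
      ext z
      exact ⟨fun hz => (H.rel r).trans hz hyD, fun hz => (H.rel r).trans hz ((H.rel r).symm hyD)⟩
    rwa [this]
  have hrel : ∀ y z, cls y = cls z ↔ H.rel r y z := by
    intro y z
    constructor
    · intro h
      have : y ∈ cls y := (H.rel r).refl y
      rw [h] at this
      exact this
    · intro h
      ext w
      exact ⟨fun hw => (H.rel r).trans hw h, fun hw => (H.rel r).trans hw ((H.rel r).symm h)⟩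
  let e : S ≃ Fin (H.n (r + 1)) := Finset.equivFinOfCardEq hcard
  -- Points outside the class `q` get the label of `x`, an arbitrary value.
  refine ⟨fun y => if h : cls y ∈ S then e ⟨cls y, h⟩ else
    e ⟨cls x, hmem x ((H.rel (r + 1)).refl x)⟩, ?_, ?_⟩
  · intro y z hy hz
    simp only
    rw [dif_pos (hmem y (Quotient.exact hy)), dif_pos (hmem z (Quotient.exact hz)),
      e.injective.eq_iff, Subtype.mk.injEq, hrel]
  · intro i
    obtain ⟨w, hw⟩ := hS _ (e.symm i).2
    have hwS : cls w ∈ S := by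
      have := (e.symm i).2
      rwa [hw] at this
    refine ⟨w, Quotient.sound ?_, ?_⟩
    · have : w ∈ {z | H.rel (r + 1) z x} := by
        rw [hC]
        exact Set.mem_iUnion₂.2 ⟨cls w, hwS, (H.rel r).refl w⟩
      exact this
    · have h2 : (⟨cls w, hwS⟩ : S) = e.symm i := Subtype.ext hw.symm
      simp only
      rw [dif_pos hwS, h2, Equiv.apply_symm_apply]

/-- The labellings of the separate classes glue, since each point only uses that of its own class.
-/
theorem exists_label (r : ℕ) : ∃ l : X → Fin (H.n (r + 1)),
    (∀ y z, H.rel (r + 1) y z → (l y = l z ↔ H.rel r y z)) ∧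
      ∀ x i, ∃ y, H.rel (r + 1) y x ∧ l y = i := by
  choose g hg hg' using H.exists_label_class r
  refine ⟨fun x => g (Quotient.mk _ x) x, fun y z hyz => ?_, fun x i => ?_⟩
  · have h : Quotient.mk (H.rel (r + 1)) y = Quotient.mk _ z := Quotient.sound hyz
    simp only [h]
    exact hg _ _ _ h rfl
  · obtain ⟨y, hy, hi⟩ := hg' (Quotient.mk _ x) i
    refine ⟨y, Quotient.exact hy, ?_⟩
    simp only [hy, hi]

/-- A permutation of `X` that maps a given point to another one and preserves all clusters of rank
at most `r`. -/
theorem exists_perm (r : ℕ) (x y : X) : ∃ σ : Equiv.Perm X, σ x = y ∧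
    ∀ s ≤ r, ∀ a b, H.rel s (σ a) (σ b) ↔ H.rel s a b := by
  classical
  choose l hl hl' using H.exists_label
  -- Sharing a cluster of rank `s` amounts to sharing one of rank `s + d` and having the same digits
  -- in positions `s, …, s + d - 1`.
  have hiff : ∀ d s : ℕ, ∀ a b, H.rel s a b ↔
      H.rel (s + d) a b ∧ ∀ t, s ≤ t → t < s + d → l t a = l t b := by
    intro d
    induction d with
    | zero => intro s a b; simp; omega
    | succ d ih =>
      intro s a b
      rw [ih s a b]
      constructor
      · rintro ⟨h1, h2⟩
        refine ⟨H.rel_succ h1, fun t ht ht' => ?_⟩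
        rcases Nat.lt_succ_iff_lt_or_eq.1 ht' with h | rfl
        · exact h2 t ht h
        · exact (hl _ a b (H.rel_succ h1)).2 h1
      · rintro ⟨h1, h2⟩
        exact ⟨(hl _ a b h1).1 (h2 _ (Nat.le_add_right s d) (Nat.lt_succ_self _)),
          fun t ht ht' => h2 t ht (Nat.lt_succ_of_lt ht')⟩
  -- Every digit string is an address: the top digit selects a subcluster, inside which the lower
  -- digits are realised by induction.
  have hsurj : ∀ k : ℕ, ∀ (q : X) (d : ∀ t : ℕ, Fin (H.n (t + 1))),
      ∃ z, H.rel k z q ∧ ∀ t < k, l t z = d t := by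
    intro k
    induction k with
    | zero => intro q d; exact ⟨q, (H.rel 0).refl q, by omega⟩
    | succ k ih =>
      intro q d
      obtain ⟨w, hw, hwd⟩ := hl' k q (d k)
      obtain ⟨z, hz, hzd⟩ := ih w d
      refine ⟨z, (H.rel (k + 1)).trans (H.rel_succ hz) hw, fun t ht => ?_⟩
      rcases Nat.lt_succ_iff_lt_or_eq.1 ht with h | rfl
      · exact hzd t h
      · rw [(hl _ z w (H.rel_succ hz)).2 hz, hwd]
  -- Coordinates on `X`: the cluster of rank `r` and the `r` digits below it.
  let Φ : X → Quotient (H.rel r) × (∀ t : Fin r, Fin (H.n (t + 1))) :=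
    fun z => (Quotient.mk _ z, fun t => l t z)
  have hΦ : Function.Bijective Φ := by
    constructor
    · intro a b hab
      have h1 : H.rel r a b := Quotient.exact (congrArg Prod.fst hab)
      have h0 : H.rel 0 a b := (hiff r 0 a b).2 ⟨(Nat.zero_add r).symm ▸ h1, fun t _ ht =>
        congrFun (congrArg Prod.snd hab) ⟨t, by simpa using ht⟩⟩
      rw [H.rank_zero] at h0
      exact h0
    · rintro ⟨q, d⟩
      induction q using Quotient.inductionOn with | h q =>
      obtain ⟨z, hz, hzd⟩ := hsurj r q (fun t => if h : t < r then d ⟨t, h⟩ else l t q)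
      refine ⟨z, Prod.ext (Quotient.sound hz) (funext fun t => ?_)⟩
      simp [Φ, hzd t t.2]
  let e := Equiv.ofBijective Φ hΦ
  -- Swapping coordinate by coordinate sends `x` to `y`. Each coordinate is permuted independently
  -- of the others, so agreement of coordinates, hence of clusters, is preserved.
  let τ := Equiv.prodCongr (Equiv.swap (Quotient.mk (H.rel r) x) (Quotient.mk (H.rel r) y))
    (Equiv.piCongrRight fun t : Fin r => Equiv.swap (l t x) (l t y))
  have key : ∀ z, Φ ((e.trans (τ.trans e.symm)) z) = τ (Φ z) := fun z =>
    e.apply_symm_apply _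
  have hrelΦ : ∀ s ≤ r, ∀ a b, H.rel s a b ↔
      (Φ a).1 = (Φ b).1 ∧ ∀ t : Fin r, s ≤ t → (Φ a).2 t = (Φ b).2 t := by
    intro s hs a b
    obtain ⟨d, rfl⟩ := Nat.exists_eq_add_of_le hs
    rw [hiff d s a b]
    refine and_congr ⟨fun h => Quotient.sound h, fun h => Quotient.exact h⟩
      ⟨fun h t ht => h t ht t.2, fun h t ht ht' => h ⟨t, ht'⟩ ht⟩
  refine ⟨e.trans (τ.trans e.symm), hΦ.1 ?_, fun s hs a b => ?_⟩
  · rw [key]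
    ext
    · simp [τ, Φ]
    · simp [τ, Φ]
  · rw [hrelΦ s hs, hrelΦ s hs, key, key]
    simp [τ]

theorem mem_cluster_perm_iff {r s : ℕ} {σ : Equiv.Perm X}
    (hσ : ∀ s ≤ r, ∀ a b, H.rel s (σ a) (σ b) ↔ H.rel s a b) (hs : s ≤ r) (a b : X) :
    σ a ∈ H.cluster s (σ b) ↔ a ∈ H.cluster s b := by
  rw [mem_cluster, mem_cluster, hσ s hs]

theorem cluster_perm {r s : ℕ} {σ : Equiv.Perm X}
    (hσ : ∀ s ≤ r, ∀ a b, H.rel s (σ a) (σ b) ↔ H.rel s a b) (hs : s ≤ r) (x : X) :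
    H.cluster s (σ x) = (H.cluster s x).map σ.toEmbedding := by
  ext z
  rw [Finset.mem_map_equiv, ← H.mem_cluster_perm_iff hσ hs (σ.symm z), Equiv.apply_symm_apply]

theorem card_cluster_eq (r : ℕ) (x y : X) : (H.cluster r x).card = (H.cluster r y).card := by
  obtain ⟨σ, rfl, hσ⟩ := H.exists_perm r x y
  rw [H.cluster_perm hσ le_rfl, Finset.card_map]

theorem exists_forall_subset_cluster (x₀ : X) (F : Finset X) :
    ∃ κ, ∀ s, κ ≤ s → F ⊆ H.cluster s x₀ := by
  classical
  induction F using Finset.induction_on with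
  | empty => exact ⟨0, by simp⟩
  | insert a F _ ih =>
    obtain ⟨κ, hκ⟩ := ih
    obtain ⟨r, hr⟩ := H.exists_rel a x₀
    refine ⟨max κ r, fun s hs => Finset.insert_subset ?_ (hκ s (le_of_max_le_left hs))⟩
    exact H.mem_cluster.2 (H.rel_mono (le_of_max_le_right hs) hr)

theorem tendsto_card_cluster [Infinite X] (x₀ : X) :
    Filter.Tendsto (fun κ => (H.cluster κ x₀).card) Filter.atTop Filter.atTop := by
  refine Filter.tendsto_atTop.2 fun m => ?_
  obtain ⟨F, hF⟩ := Infinite.exists_subset_card_eq X m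
  obtain ⟨κ, hκ⟩ := H.exists_forall_subset_cluster x₀ F
  filter_upwards [Filter.eventually_ge_atTop κ] with s hs
  exact hF ▸ Finset.card_le_card (hκ s hs)

end HierarchicalStructure

/-! ### Enumerating the clusters of a fixed rank along the exhaustion. -/

/-- An increasing exhaustion by finite sets can be enumerated so that each of its members is an
initial segment. -/
theorem exists_enumeration {I : Type*} [Countable I] [Infinite I] (S : ℕ → Finset I)
    (hmono : Monotone S) (hex : ∀ i, ∃ κ, i ∈ S κ) :
    ∃ e : ℕ → I, Function.Injective e ∧
      ∀ κ, (S κ : Set I) = e '' Set.Iio (S κ).card := by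
  classical
  obtain ⟨code, hcode⟩ := exists_injective_nat I
  let lev : I → ℕ := fun i => Nat.find (hex i)
  have hlev : ∀ i κ, i ∈ S κ ↔ lev i ≤ κ := fun i κ =>
    ⟨fun h => Nat.find_min' _ h, fun h => hmono h (Nat.find_spec (hex i))⟩
  -- Ordering by time of entry, with ties broken by an injective code, makes every `S κ` a lower
  -- set. Each element has finitely many predecessors, and their number is its position.
  let f : I → ℕ ×ₗ ℕ := fun i => toLex (lev i, code i)
  have hf : Function.Injective f := fun i j hij => hcode (by
    have := congrArg (fun z => (ofLex z).2) hij
    exact this)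
  have hlt : ∀ i j κ, f j ≤ f i → i ∈ S κ → j ∈ S κ := by
    intro i j κ hji hi
    rw [hlev] at hi ⊢
    exact (Prod.Lex.monotone_fst _ _ hji).trans hi
  let below : I → Finset I := fun i => {j ∈ S (lev i) | f j < f i}
  have hbelow : ∀ i j, j ∈ below i ↔ f j < f i := fun i j => by
    simp only [below, Finset.mem_filter, and_iff_right_iff_imp]
    exact fun h => hlt i j _ h.le ((hlev i _).2 le_rfl)
  let pos : I → ℕ := fun i => (below i).card
  have hpos : ∀ i j, f i < f j → pos i < pos j := by
    intro i j hij
    refine Finset.card_lt_card ⟨fun k hk => ?_, fun h => ?_⟩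
    · rw [hbelow] at hk ⊢
      exact hk.trans hij
    · have := h ((hbelow j i).2 hij)
      rw [hbelow] at this
      exact lt_irrefl _ this
  have hinj : Function.Injective pos := by
    intro i j hij
    by_contra hne
    rcases lt_or_gt_of_ne (fun h => hne (hf h)) with h | h
    · exact (hpos _ _ h).ne hij
    · exact (hpos _ _ h).ne' hij
  have himg : ∀ κ, (S κ).image pos = Finset.range (S κ).card := by
    intro κ
    refine Finset.eq_of_subset_of_card_le (fun m hm => ?_) ?_
    · obtain ⟨i, hi, rfl⟩ := Finset.mem_image.1 hm
      rw [Finset.mem_range]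
      refine Finset.card_lt_card ⟨fun k hk => hlt i k κ ((hbelow i k).1 hk).le hi, fun h => ?_⟩
      exact lt_irrefl _ ((hbelow i i).1 (h hi))
    · rw [Finset.card_image_of_injective _ hinj, Finset.card_range]
  have hsurj : Function.Surjective pos := by
    intro m
    obtain ⟨F, hF⟩ := Infinite.exists_subset_card_eq I (m + 1)
    have : ∃ κ, F ⊆ S κ := by
      refine ⟨F.sup lev, fun i hi => (hlev i _).2 (Finset.le_sup hi)⟩
    obtain ⟨κ, hκ⟩ := this
    have hm : m ∈ (S κ).image pos := by
      rw [himg, Finset.mem_range]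
      have := Finset.card_le_card hκ
      omega
    obtain ⟨i, -, hi⟩ := Finset.mem_image.1 hm
    exact ⟨i, hi⟩
  let E := Equiv.ofBijective pos ⟨hinj, hsurj⟩
  refine ⟨E.symm, E.symm.injective, fun κ => ?_⟩
  rw [Equiv.image_symm_eq_preimage]
  ext i
  have h := congrArg (fun T => pos i ∈ T) (himg κ)
  simp only [Finset.mem_image, Finset.mem_range, hinj.eq_iff, exists_eq_right, eq_iff_iff] at h
  exact h

namespace HierarchicalStructure

variable {X : Type*} (H : HierarchicalStructure X)

/-- The clusters of rank `r` can be enumerated so that each cluster around `x₀` of larger rank is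
the union of an initial segment. -/
theorem exists_cluster_enumeration [Countable X] [Infinite X] (x₀ : X) (r : ℕ) :
    ∃ (e : ℕ → X) (m : ℕ → ℕ), (∀ i j, i ≠ j → Disjoint (H.cluster r (e i)) (H.cluster r (e j))) ∧
      (∀ κ, r ≤ κ → (H.cluster κ x₀ : Set X) = ⋃ i ∈ Finset.range (m κ), (H.cluster r (e i) : Set X)) ∧
      ∀ κ, r ≤ κ → (H.cluster κ x₀).card = m κ * (H.cluster r x₀).card := by
  classical
  let S : ℕ → Finset (Quotient (H.rel r)) := fun κ => (H.cluster κ x₀).image (Quotient.mk _)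
  have hmono : Monotone S := fun a b hab => Finset.image_subset_image (H.cluster_mono hab x₀)
  have hex : ∀ q, ∃ κ, q ∈ S κ := by
    intro q
    induction q using Quotient.inductionOn with | h q =>
    obtain ⟨κ, hκ⟩ := H.exists_rel q x₀
    exact ⟨κ, Finset.mem_image_of_mem _ (H.mem_cluster.2 hκ)⟩
  -- Clusters are finite, so finitely many of them cannot cover `X`.
  have hinf : Infinite (Quotient (H.rel r)) := by
    by_contra hfin
    rw [not_infinite_iff_finite] at hfin
    refine not_finite_iff_infinite.2 ‹Infinite X› ?_
    refine Set.finite_univ_iff.1 (Set.Finite.of_finite_fibers (Quotient.mk (H.rel r))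
      (Set.toFinite _) fun q _ => ?_)
    induction q using Quotient.inductionOn with | h q =>
    exact (H.cluster_finite r q).subset fun z hz => Quotient.exact hz.2
  obtain ⟨e, he, hS⟩ := exists_enumeration S hmono hex
  have hdisj : ∀ i j, i ≠ j →
      Disjoint (H.cluster r (e i).out) (H.cluster r (e j).out) := by
    intro i j hij
    rw [Finset.disjoint_left]
    intro z hz hz'
    rw [mem_cluster] at hz hz'
    refine hij (he ?_)
    rw [← Quotient.out_eq (e i), ← Quotient.out_eq (e j)]
    exact Quotient.sound ((H.rel r).trans ((H.rel r).symm hz) hz')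
  have hunion : ∀ κ, r ≤ κ → (H.cluster κ x₀ : Set X) =
      ⋃ i ∈ Finset.range (S κ).card, (H.cluster r (e i).out : Set X) := by
    intro κ hκ
    ext z
    have h1 : z ∈ H.cluster κ x₀ ↔ Quotient.mk (H.rel r) z ∈ S κ := by
      refine ⟨fun h => Finset.mem_image_of_mem _ h, fun h => ?_⟩
      obtain ⟨w, hw, hwz⟩ := Finset.mem_image.1 h
      rw [mem_cluster] at hw ⊢
      exact (H.rel κ).trans ((H.rel κ).symm (H.rel_mono hκ (Quotient.exact hwz))) hw
    rw [Finset.mem_coe, h1, ← Finset.mem_coe, hS]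
    simp only [Set.mem_image, Set.mem_Iio, Finset.mem_range, Set.mem_iUnion, Finset.mem_coe,
      mem_cluster, exists_prop]
    refine exists_congr fun i => and_congr_right fun _ => ?_
    rw [eq_comm, ← Quotient.out_eq (e i), Quotient.eq, Quotient.out_eq]
  refine ⟨fun i => (e i).out, fun κ => (S κ).card, hdisj, hunion, fun κ hκ => ?_⟩
  have : H.cluster κ x₀ = (Finset.range (S κ).card).biUnion fun i => H.cluster r (e i).out := by
    rw [← Finset.coe_inj, hunion κ hκ]
    push_cast
    simp
  rw [this, Finset.card_biUnion fun i _ j _ hij => hdisj i j hij]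
  simp [H.card_cluster_eq r _ x₀]

end HierarchicalStructure

/-! ### Truncated Hamiltonians and norm estimates. -/

section FiniteRange

variable {X : Type*} (H : HierarchicalStructure X) (p : ℕ → ℝ)

/-- The truncation `∑_{s ≤ r} p_s E_s + V^ω` of the Hamiltonian, acting on arbitrary functions. -/
def finiteRange (r : ℕ) (ω : X → ℝ) (ψ : X → ℂ) (x : X) : ℂ :=
  ∑ s ∈ Finset.Icc 1 r, (p s : ℂ) * H.avg s ψ x + (ω x : ℂ) * ψ x

open Classical in
/-- The diagonal matrix element at `x` of the `k`-th power of the truncated Hamiltonian. -/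
def diagMoment (r k : ℕ) (ω : X → ℝ) (x : X) : ℝ :=
  ((finiteRange H p r ω)^[k] (Pi.single x 1) x).re

/-- The truncation `∑_{s ≤ r} p_s E_s + V^ω` of the Hamiltonian as an operator on `ℓ²(X)`. -/
def finiteRangeOp (r : ℕ) (ω : X → ℝ) : L2 X →L[ℂ] L2 X :=
  ∑ s ∈ Finset.Icc 1 r, (p s : ℂ) • H.averaging s + potential ω

theorem coe_finiteRangeOp (r : ℕ) {ω : X → ℝ} (hω : ∃ C : ℝ, ∀ x, |ω x| ≤ C) (ψ : L2 X) :
    (finiteRangeOp H p r ω ψ : X → ℂ) = finiteRange H p r ω ψ := by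
  have hsum : ∀ (F : Finset ℕ) (x : X), ((∑ s ∈ F, (p s : ℂ) • H.averaging s) ψ : L2 X) x =
      ∑ s ∈ F, (p s : ℂ) * H.avg s ψ x := by
    classical
    intro F x
    induction F using Finset.induction_on with
    | empty => simp
    | insert a F ha ih =>
      rw [Finset.sum_insert ha, Finset.sum_insert ha, ← ih]
      rfl
  ext x
  change ((∑ s ∈ Finset.Icc 1 r, (p s : ℂ) • H.averaging s) ψ : L2 X) x + potential ω ψ x = _
  rw [hsum, potential_apply ω hω]
  rfl

theorem coe_finiteRangeOp_pow (r k : ℕ) {ω : X → ℝ} (hω : ∃ C : ℝ, ∀ x, |ω x| ≤ C) (ψ : L2 X) :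
    ((finiteRangeOp H p r ω ^ k) ψ : X → ℂ) = (finiteRange H p r ω)^[k] ψ := by
  induction k with
  | zero => rfl
  | succ k ih =>
    rw [pow_succ', Function.iterate_succ_apply', ← ih, ← coe_finiteRangeOp H p r hω]
    rfl

open Classical in
theorem diagMoment_eq (r k : ℕ) {ω : X → ℝ} (hω : ∃ C : ℝ, ∀ x, |ω x| ≤ C) (x : X) :
    diagMoment H p r k ω x = ((finiteRangeOp H p r ω ^ k) (lp.single 2 x (1 : ℂ)) x).re := by
  rw [coe_finiteRangeOp_pow H p r k hω, diagMoment, lp.coeFn_single]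

theorem norm_averaging_le (s : ℕ) : ‖H.averaging s‖ ≤ 1 :=
  LinearMap.mkContinuous_norm_le _ zero_le_one _

theorem norm_potential_le {ω : X → ℝ} {C : ℝ} (hC : 0 ≤ C) (hω : ∀ x, |ω x| ≤ C) :
    ‖potential ω‖ ≤ C := by
  refine ContinuousLinearMap.opNorm_le_bound _ hC fun ψ => ?_
  refine lp.norm_le_of_forall_sum_le (by norm_num) (by positivity) fun F => ?_
  have := sum_norm_mul_sq_le ω C hω ψ F
  rw [abs_of_nonneg hC] at this
  simpa [potential_apply ω ⟨C, hω⟩] using this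

theorem potential_add_const {ω : X → ℝ} (hω : ∃ C : ℝ, ∀ x, |ω x| ≤ C) (c : ℝ) :
    potential (fun x => ω x + c) = potential ω + (c : ℂ) • 1 := by
  have h : ∃ C : ℝ, ∀ x, |ω x + c| ≤ C := by
    obtain ⟨C, hC⟩ := hω
    exact ⟨C + |c|, fun x => (abs_add_le _ _).trans (by gcongr; exact hC x)⟩
  ext ψ x
  change potential (fun x => ω x + c) ψ x = potential ω ψ x + (c : ℂ) * ψ x
  rw [potential_apply _ h, potential_apply _ hω]
  push_cast
  ring

theorem norm_sum_averaging_le (F : Finset ℕ) (hp : ∀ s ∈ F, 0 ≤ p s) :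
    ‖∑ s ∈ F, (p s : ℂ) • H.averaging s‖ ≤ ∑ s ∈ F, p s := by
  refine norm_sum_le_of_le _ fun s hs => ?_
  rw [norm_smul, Complex.norm_real, Real.norm_of_nonneg (hp s hs)]
  exact mul_le_of_le_one_right (hp s hs) (norm_averaging_le H s)

/-- The weight `∑_{s > r} p_s`. -/
def tailWeight (r : ℕ) : ℝ := ∑' s : ℕ, p (r + 1 + s)

variable {p} (hp : ∀ s : ℕ, 1 ≤ s → 0 < p s ∧ p s < 1) (hsum : HasSum (fun s : ℕ => p (s + 1)) 1)

include hp in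
theorem tailWeight_nonneg (r : ℕ) : 0 ≤ tailWeight p r :=
  tsum_nonneg fun s => (hp _ (by omega)).1.le

theorem sum_Icc_one_eq_range {M : Type*} [AddCommMonoid M] (f : ℕ → M) (r : ℕ) :
    ∑ s ∈ Finset.Icc 1 r, f s = ∑ s ∈ Finset.range r, f (s + 1) := by
  rw [Finset.range_eq_Ico, Finset.sum_Ico_add' f 0 r 1]
  rfl

include hsum in
theorem sum_add_tailWeight (r : ℕ) : ∑ s ∈ Finset.Icc 1 r, p s + tailWeight p r = 1 := by
  rw [sum_Icc_one_eq_range, ← hsum.tsum_eq, ← hsum.summable.sum_add_tsum_nat_add r, tailWeight]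
  congr 2
  ext s
  congr 1
  ring

theorem tendsto_tailWeight : Filter.Tendsto (tailWeight p) Filter.atTop (nhds 0) := by
  convert tendsto_sum_nat_add (fun s : ℕ => p (s + 1)) using 2 with r
  rw [tailWeight]
  congr 1
  ext s
  congr 1
  ring

include hp hsum in
theorem summable_averaging :
    Summable fun s : ℕ => (p (s + 1) : ℂ) • H.averaging (s + 1) := by
  refine Summable.of_norm_bounded hsum.summable fun s => ?_
  have := (hp (s + 1) (by omega)).1.le
  rw [norm_smul, Complex.norm_real, Real.norm_of_nonneg this]
  exact mul_le_of_le_one_right this (norm_averaging_le H _)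

include hp hsum in
-- The difference is the tail of the series for the Laplacian, and every averaging operator is a
-- contraction.
theorem norm_hamiltonian_sub_le (r : ℕ) (ω : X → ℝ) :
    ‖hamiltonian H p ω - finiteRangeOp H p r ω‖ ≤ tailWeight p r := by
  have h : hamiltonian H p ω - finiteRangeOp H p r ω =
      ∑' s : ℕ, (p (s + r + 1) : ℂ) • H.averaging (s + r + 1) := by
    rw [hamiltonian, finiteRangeOp, HierarchicalStructure.laplacian,
      ← (summable_averaging H hp hsum).sum_add_tsum_nat_add r, sum_Icc_one_eq_range]
    abel
  rw [h]
  have hs : Summable fun s : ℕ => p (s + r + 1) := (summable_nat_add_iff r).2 hsum.summable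
  have ht : tailWeight p r = ∑' s : ℕ, p (s + r + 1) := by
    rw [tailWeight]
    congr 1
    ext s
    congr 1
    ring
  rw [ht]
  refine tsum_of_norm_bounded hs.hasSum fun s => ?_
  have := (hp (s + r + 1) (by omega)).1.le
  rw [norm_smul, Complex.norm_real, Real.norm_of_nonneg this]
  exact mul_le_of_le_one_right this (norm_averaging_le H _)

include hp hsum in
-- The shift `c` does not exceed the weight removed by truncation, so weights and shift add up to at
-- most `1`. This gives one bound for both boundary conditions and all ranks.
theorem norm_finiteRangeOp_add_const_le (r : ℕ) {ω : X → ℝ} {C c : ℝ} (hC : 0 ≤ C)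
    (hω : ∀ x, |ω x| ≤ C) (hc : 0 ≤ c) (hcr : c ≤ tailWeight p r) :
    ‖finiteRangeOp H p r fun x => ω x + c‖ ≤ 1 + C := by
  rw [finiteRangeOp, potential_add_const ⟨C, hω⟩]
  have h1 := norm_sum_averaging_le H p (Finset.Icc 1 r)
    fun s hs => (hp s (Finset.mem_Icc.1 hs).1).1.le
  have h2 := norm_potential_le hC hω
  have h3 : ‖(c : ℂ) • (1 : L2 X →L[ℂ] L2 X)‖ ≤ c := by
    rw [norm_smul, Complex.norm_real, Real.norm_of_nonneg hc]
    exact mul_le_of_le_one_right hc ContinuousLinearMap.norm_id_le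
  have h4 := sum_add_tailWeight hsum r
  have h5 := norm_add_le (∑ s ∈ Finset.Icc 1 r, (p s : ℂ) • H.averaging s)
    (potential ω + (c : ℂ) • 1)
  have h6 := norm_add_le (potential ω) ((c : ℂ) • (1 : L2 X →L[ℂ] L2 X))
  linarith

include hp hsum in
theorem norm_finiteRangeOp_le (r : ℕ) {ω : X → ℝ} {C : ℝ} (hC : 0 ≤ C)
    (hω : ∀ x, |ω x| ≤ C) : ‖finiteRangeOp H p r ω‖ ≤ 1 + C := by
  simpa using norm_finiteRangeOp_add_const_le H hp hsum r hC hω le_rfl (tailWeight_nonneg hp r)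

include hp hsum in
-- The ranks in `(r, κ]` and the shift together weigh no more than the whole tail beyond `r`, which
-- is why the error is uniform in `κ`.
theorem norm_finiteRangeOp_sub_le {r κ : ℕ} (hr : r ≤ κ) {ω : X → ℝ}
    (hω : ∃ C : ℝ, ∀ x, |ω x| ≤ C) {c : ℝ} (hc : 0 ≤ c) (hcr : c ≤ tailWeight p κ) :
    ‖(finiteRangeOp H p κ fun x => ω x + c) - finiteRangeOp H p r ω‖ ≤ tailWeight p r := by
  have hU : ∀ {M : Type _} [AddCommMonoid M] (f : ℕ → M), ∑ s ∈ Finset.Icc 1 κ, f s =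
      ∑ s ∈ Finset.Icc 1 r, f s + ∑ s ∈ Finset.Ico (r + 1) (κ + 1), f s := fun f =>
    (Finset.sum_Ico_consecutive f (Nat.le_add_left 1 r) (Nat.succ_le_succ hr)).symm
  have hU' : ∑ s ∈ Finset.Icc 1 κ, p s =
      ∑ s ∈ Finset.Icc 1 r, p s + ∑ s ∈ Finset.Ico (r + 1) (κ + 1), p s :=
    (Finset.sum_Ico_consecutive p (Nat.le_add_left 1 r) (Nat.succ_le_succ hr)).symm
  have h : (finiteRangeOp H p κ fun x => ω x + c) - finiteRangeOp H p r ω =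
      ∑ s ∈ Finset.Ico (r + 1) (κ + 1), (p s : ℂ) • H.averaging s + (c : ℂ) • 1 := by
    rw [finiteRangeOp, finiteRangeOp, potential_add_const hω, hU]
    abel
  have h1 := norm_sum_averaging_le H p (Finset.Ico (r + 1) (κ + 1))
    fun s hs => (hp s (by have := (Finset.mem_Ico.1 hs).1; omega)).1.le
  have h3 : ‖(c : ℂ) • (1 : L2 X →L[ℂ] L2 X)‖ ≤ c := by
    rw [norm_smul, Complex.norm_real, Real.norm_of_nonneg hc]
    exact mul_le_of_le_one_right hc ContinuousLinearMap.norm_id_le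
  have h4 := sum_add_tailWeight hsum r
  have h5 := sum_add_tailWeight hsum κ
  rw [h]
  have h6 := norm_add_le (∑ s ∈ Finset.Ico (r + 1) (κ + 1), (p s : ℂ) • H.averaging s)
    ((c : ℂ) • 1)
  linarith

include hp hsum in
theorem norm_hamiltonian_le {ω : X → ℝ} {C : ℝ} (hC : 0 ≤ C) (hω : ∀ x, |ω x| ≤ C) :
    ‖hamiltonian H p ω‖ ≤ 1 + C := by
  -- At rank `0` only the potential survives and the tail has weight `1`.
  have h0 := norm_hamiltonian_sub_le H hp hsum 0 ω
  have h1 : tailWeight p 0 = 1 := by simpa using sum_add_tailWeight hsum 0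
  have h2 : finiteRangeOp H p 0 ω = potential ω := by simp [finiteRangeOp]
  rw [h1, h2] at h0
  calc ‖hamiltonian H p ω‖ = ‖(hamiltonian H p ω - potential ω) + potential ω‖ := by
        rw [sub_add_cancel]
    _ ≤ _ := norm_add_le _ _
    _ ≤ 1 + C := add_le_add h0 (norm_potential_le hC hω)

end FiniteRange

/-! ### Powers of operators and their diagonal elements. -/

section Powers

theorem norm_pow_le_of_norm_le {E : Type*} [NormedAddCommGroup E] [NormedSpace ℂ E]
    {A : E →L[ℂ] E} {R : ℝ} (hA : ‖A‖ ≤ R) (k : ℕ) : ‖A ^ k‖ ≤ R ^ k := by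
  induction k with
  | zero => exact (ContinuousLinearMap.norm_id_le (𝕜 := ℂ) (E := E)).trans_eq (pow_zero R).symm
  | succ k ih =>
    rw [pow_succ, pow_succ]
    exact (norm_mul_le _ _).trans (by gcongr; exact (norm_nonneg _).trans ih)

/-- One factor is exchanged at a time; `1 ≤ R` lets every term be bounded by the same power of `R`.
-/
theorem norm_pow_sub_pow_le {E : Type*} [NormedAddCommGroup E] [NormedSpace ℂ E]
    {A B : E →L[ℂ] E} {R : ℝ} (hR : 1 ≤ R) (hA : ‖A‖ ≤ R) (hB : ‖B‖ ≤ R) (k : ℕ) :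
    ‖A ^ k - B ^ k‖ ≤ k * R ^ k * ‖A - B‖ := by
  induction k with
  | zero => simp
  | succ k ih =>
    have h : A ^ (k + 1) - B ^ (k + 1) = A * (A ^ k - B ^ k) + (A - B) * B ^ k := by
      rw [pow_succ', pow_succ']
      noncomm_ring
    have h1 : ‖A * (A ^ k - B ^ k)‖ ≤ R * (k * R ^ k * ‖A - B‖) :=
      (norm_mul_le _ _).trans (mul_le_mul hA ih (norm_nonneg _) (by linarith))
    have h2 : ‖(A - B) * B ^ k‖ ≤ ‖A - B‖ * R ^ k :=
      (norm_mul_le _ _).trans (by gcongr; exact norm_pow_le_of_norm_le hB k)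
    have h3 : R ^ k ≤ R ^ (k + 1) := pow_le_pow_right₀ hR (Nat.le_succ k)
    have h4 : ‖A - B‖ * R ^ k ≤ ‖A - B‖ * R ^ (k + 1) := by gcongr
    rw [h]
    refine (norm_add_le _ _).trans ((add_le_add h1 (h2.trans h4)).trans (le_of_eq ?_))
    push_cast
    ring

variable {X : Type*}

open Classical in
theorem abs_re_apply_single_le (A : L2 X →L[ℂ] L2 X) (x : X) :
    |(A (lp.single 2 x (1 : ℂ)) x).re| ≤ ‖A‖ := by
  refine (Complex.abs_re_le_norm _).trans ((lp.norm_apply_le_norm (by norm_num) _ x).trans ?_)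
  refine (A.le_opNorm _).trans ?_
  rw [lp.norm_single (by norm_num)]
  simp

open Classical in
theorem abs_re_pow_apply_single_sub_le {A B : L2 X →L[ℂ] L2 X} {R : ℝ} (hR : 1 ≤ R) (hA : ‖A‖ ≤ R)
    (hB : ‖B‖ ≤ R) (k : ℕ) (x : X) :
    |((A ^ k) (lp.single 2 x (1 : ℂ)) x).re - ((B ^ k) (lp.single 2 x (1 : ℂ)) x).re| ≤
      k * R ^ k * ‖A - B‖ :=
  (abs_re_apply_single_le (A ^ k - B ^ k) x).trans (norm_pow_sub_pow_le hR hA hB k)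

end Powers

/-! ### Finite-volume traces as sums of local moments. -/

section Trace

variable {X : Type*} (H : HierarchicalStructure X) (p : ℕ → ℝ)

/-- The energy shift of a finite-volume restriction. -/
def Restriction.shift (κ : ℕ) : Restriction → ℝ
  | .neumann => 0
  | .dirichlet => tailWeight p κ

open Classical in
theorem averagingMatrix_mulVec {x₀ : X} {κ s : ℕ} (hs : s ≤ κ) (φ : X → ℂ) (x : H.cluster κ x₀) :
    (averagingMatrix H x₀ κ s).mulVec (fun y => φ y) x = H.avg s φ x := by
  have hsub : H.cluster s (x : X) ⊆ H.cluster κ x₀ := fun y hy => by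
    rw [← H.cluster_eq_of_mem x.2]
    exact H.cluster_mono hs _ hy
  simp only [Matrix.mulVec, dotProduct, averagingMatrix, Matrix.of_apply, ite_mul, zero_mul]
  rw [Finset.sum_coe_sort (H.cluster κ x₀) (fun y => if y ∈ H.cluster s (x : X) then
    ((H.cluster s (x : X)).card : ℂ)⁻¹ * φ y else 0), ← Finset.sum_filter,
    Finset.filter_mem_eq_inter, Finset.inter_eq_right.2 hsub, HierarchicalStructure.avg,
    Finset.mul_sum]

open Classical in
-- Averages of rank at most `κ` at a point of `Q_κ` never look outside `Q_κ`, so there are no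
-- boundary terms: the matrix acts as the truncated operator does, and the Dirichlet term acts as a
-- constant potential.
theorem hamiltonianMatrix_mulVec (x₀ : X) (κ : ℕ) (b : Restriction) (ω : X → ℝ) (φ : X → ℂ)
    (x : H.cluster κ x₀) :
    (hamiltonianMatrix H p x₀ κ b ω).mulVec (fun y => φ y) x =
      finiteRange H p κ (fun x => ω x + b.shift p κ) φ x := by
  have h : (∑ s ∈ Finset.Icc 1 κ, (p s : ℂ) • averagingMatrix H x₀ κ s).mulVec
      (fun y => φ y) x = ∑ s ∈ Finset.Icc 1 κ, (p s : ℂ) * H.avg s φ x := by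
    rw [Matrix.sum_mulVec, Finset.sum_apply]
    refine Finset.sum_congr rfl fun s hs => ?_
    rw [Matrix.smul_mulVec, Pi.smul_apply, averagingMatrix_mulVec H (Finset.mem_Icc.1 hs).2,
      smul_eq_mul]
  cases b with
  | neumann =>
    simp only [hamiltonianMatrix, laplacianMatrix, Matrix.add_mulVec, Pi.add_apply, h,
      Matrix.mulVec_diagonal, finiteRange, Restriction.shift, add_zero]
  | dirichlet =>
    simp only [hamiltonianMatrix, laplacianMatrix, Matrix.add_mulVec, Pi.add_apply, h,
      Matrix.mulVec_diagonal, finiteRange, Restriction.shift, Matrix.scalar_apply, tailWeight]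
    push_cast
    ring

open Classical in
theorem hamiltonianMatrix_pow_apply (x₀ : X) (κ k : ℕ) (b : Restriction) (ω : X → ℝ)
    (x y : H.cluster κ x₀) :
    (hamiltonianMatrix H p x₀ κ b ω ^ k) x y =
      (finiteRange H p κ (fun x => ω x + b.shift p κ))^[k] (Pi.single (y : X) 1) x := by
  induction k generalizing x with
  | zero => simp only [pow_zero, Matrix.one_apply, Function.iterate_zero, id, Pi.single_apply,
      Subtype.ext_iff]
  | succ k ih =>
    rw [pow_succ', Function.iterate_succ_apply', ← hamiltonianMatrix_mulVec, Matrix.mul_apply]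
    simp only [ih, Matrix.mulVec, dotProduct]

theorem trace_pow_eq_sum_eigenvalues {n : Type*} [Fintype n] [DecidableEq n] {A : Matrix n n ℂ}
    (hA : A.IsHermitian) (k : ℕ) : (A ^ k).trace = ∑ i, (hA.eigenvalues i : ℂ) ^ k := by
  conv_lhs => rw [hA.spectral_theorem, ← map_pow, Unitary.conjStarAlgAut_apply,
    Matrix.trace_mul_cycle, Matrix.diagonal_pow]
  simp [Matrix.trace_diagonal]

open Classical in
theorem sum_eigenvalues_pow (x₀ : X) (κ k : ℕ) (b : Restriction) (ω : X → ℝ) :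
    ∑ j, (isHermitian_hamiltonianMatrix H p x₀ κ b ω).eigenvalues j ^ k =
      ∑ x ∈ H.cluster κ x₀, diagMoment H p κ k (fun x => ω x + b.shift p κ) x := by
  have h := congrArg Complex.re
    (trace_pow_eq_sum_eigenvalues (isHermitian_hamiltonianMatrix H p x₀ κ b ω) k)
  rw [Matrix.trace, Complex.re_sum, Complex.re_sum] at h
  simp only [← Complex.ofReal_pow, Complex.ofReal_re, Matrix.diag_apply,
    hamiltonianMatrix_pow_apply] at h
  rw [← h]
  exact Finset.sum_coe_sort (H.cluster κ x₀)
    (fun x => diagMoment H p κ k (fun x => ω x + b.shift p κ) x)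

end Trace

/-! ### Locality, invariance, and the strong law of large numbers. -/

section Probability

variable {X : Type*} (H : HierarchicalStructure X) (p : ℕ → ℝ)

theorem measurable_finiteRange_iterate (r k : ℕ) (φ : X → ℂ) (x : X) :
    Measurable fun ω : X → ℝ => (finiteRange H p r ω)^[k] φ x := by
  induction k generalizing x with
  | zero => exact measurable_const
  | succ k ih =>
    simp only [Function.iterate_succ_apply', finiteRange, HierarchicalStructure.avg]
    refine Measurable.add ?_ ?_
    · exact Finset.measurable_sum _ fun s _ => ((Finset.measurable_sum _ fun y _ =>
        ih y).const_mul _).const_mul _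
    · exact (Complex.measurable_ofReal.comp (measurable_pi_apply x)).mul (ih x)

theorem measurable_diagMoment (r k : ℕ) (x : X) :
    Measurable fun ω : X → ℝ => diagMoment H p r k ω x :=
  Complex.measurable_re.comp (measurable_finiteRange_iterate H p r k _ x)

/-- Locality: iterating the truncated operator never leaves the cluster of rank `r`. Independence of
cluster traces rests on this. -/
theorem finiteRange_iterate_congr {r : ℕ} (k : ℕ) {ω ω' : X → ℝ} {x : X}
    (h : ∀ y ∈ H.cluster r x, ω y = ω' y) (φ : X → ℂ) :
    ∀ y ∈ H.cluster r x, (finiteRange H p r ω)^[k] φ y = (finiteRange H p r ω')^[k] φ y := by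
  induction k with
  | zero => exact fun _ _ => rfl
  | succ k ih =>
    intro y hy
    simp only [Function.iterate_succ_apply', finiteRange, HierarchicalStructure.avg]
    rw [h y hy, ih y hy]
    congr 1
    refine Finset.sum_congr rfl fun s hs => ?_
    congr 2
    refine Finset.sum_congr rfl fun z hz => ih z ?_
    rw [← H.cluster_eq_of_mem hy]
    exact H.cluster_mono (Finset.mem_Icc.1 hs).2 y hz

theorem diagMoment_congr {r : ℕ} (k : ℕ) {ω ω' : X → ℝ} {x : X}
    (h : ∀ y ∈ H.cluster r x, ω y = ω' y) :
    diagMoment H p r k ω x = diagMoment H p r k ω' x :=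
  congrArg Complex.re (finiteRange_iterate_congr H p k h _ x (H.self_mem_cluster r x))

/-- Covariance under cluster-preserving permutations. Since the product law is invariant under
permuting sites, it makes local moments identically distributed. -/
theorem finiteRange_iterate_perm {r : ℕ} (k : ℕ) {σ : Equiv.Perm X}
    (hσ : ∀ s ≤ r, ∀ a b, H.rel s (σ a) (σ b) ↔ H.rel s a b) (ω : X → ℝ) (φ : X → ℂ) (x : X) :
    (finiteRange H p r ω)^[k] φ (σ x) = (finiteRange H p r (ω ∘ σ))^[k] (φ ∘ σ) x := by
  induction k generalizing x with
  | zero => rfl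
  | succ k ih =>
    simp only [Function.iterate_succ_apply', finiteRange, HierarchicalStructure.avg]
    rw [ih x]
    congr 1
    refine Finset.sum_congr rfl fun s hs => ?_
    rw [H.cluster_perm hσ (Finset.mem_Icc.1 hs).2, Finset.card_map, Finset.sum_map]
    simp only [Equiv.coe_toEmbedding, ih]

theorem diagMoment_perm {r : ℕ} (k : ℕ) {σ : Equiv.Perm X}
    (hσ : ∀ s ≤ r, ∀ a b, H.rel s (σ a) (σ b) ↔ H.rel s a b) (ω : X → ℝ) (x : X) :
    diagMoment H p r k ω (σ x) = diagMoment H p r k (ω ∘ σ) x := by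
  classical
  rw [diagMoment, diagMoment, finiteRange_iterate_perm H p k hσ]
  have h : (Pi.single (σ x) 1 : X → ℂ) ∘ σ = Pi.single x 1 := by
    ext z
    simp [Pi.single_apply]
  rw [h]

theorem measurePreserving_comp_perm (P₀ : Measure ℝ) [IsProbabilityMeasure P₀]
    (σ : Equiv.Perm X) :
    MeasurePreserving (fun ω : X → ℝ => ω ∘ σ) (law X P₀) (law X P₀) :=
  ⟨by fun_prop, Measure.map_infinitePi_infinitePi_of_inj (P := fun _ : X => P₀) σ.injective⟩

theorem ae_forall_mem_of_support_subset [Countable X] (P₀ : Measure ℝ) [IsProbabilityMeasure P₀]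
    {K : Set ℝ} (hK : P₀.support ⊆ K) : ∀ᵐ ω ∂(law X P₀), ∀ x, ω x ∈ K := by
  rw [ae_all_iff]
  intro x
  have h : ∀ᵐ t ∂P₀, t ∈ K := Filter.mem_of_superset Measure.support_mem_ae hK
  exact (measurePreserving_eval_infinitePi (fun _ : X => P₀) x).quasiMeasurePreserving.ae h

/-- The trace over the cluster of rank `r` around `x` of a power of the truncated Hamiltonian. -/
def clusterTrace (r k : ℕ) (x : X) (ω : X → ℝ) : ℝ :=
  ∑ z ∈ H.cluster r x, diagMoment H p r k ω z

theorem measurable_clusterTrace (r k : ℕ) (x : X) : Measurable (clusterTrace H p r k x) :=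
  Finset.measurable_sum _ fun z _ => measurable_diagMoment H p r k z

theorem identDistrib_diagMoment (P₀ : Measure ℝ) [IsProbabilityMeasure P₀] (r k : ℕ) (x y : X) :
    IdentDistrib (fun ω => diagMoment H p r k ω y) (fun ω => diagMoment H p r k ω x)
      (law X P₀) (law X P₀) := by
  obtain ⟨σ, rfl, hσ⟩ := H.exists_perm r x y
  refine ⟨(measurable_diagMoment H p r k _).aemeasurable,
    (measurable_diagMoment H p r k _).aemeasurable, ?_⟩
  simp only [diagMoment_perm H p k hσ]
  have hm := measurePreserving_comp_perm (X := X) P₀ σ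
  conv_rhs => rw [← hm.map_eq, Measure.map_map (measurable_diagMoment H p r k x) hm.measurable]
  rfl

theorem identDistrib_clusterTrace (P₀ : Measure ℝ) [IsProbabilityMeasure P₀] (r k : ℕ) (x y : X) :
    IdentDistrib (clusterTrace H p r k y) (clusterTrace H p r k x) (law X P₀) (law X P₀) := by
  obtain ⟨σ, rfl, hσ⟩ := H.exists_perm r x y
  refine ⟨(measurable_clusterTrace H p r k _).aemeasurable,
    (measurable_clusterTrace H p r k _).aemeasurable, ?_⟩
  have hm := measurePreserving_comp_perm (X := X) P₀ σ
  have h : clusterTrace H p r k (σ x) = clusterTrace H p r k x ∘ fun ω => ω ∘ σ := by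
    ext ω
    simp only [clusterTrace, Function.comp_def, H.cluster_perm hσ le_rfl, Finset.sum_map,
      Equiv.coe_toEmbedding]
    exact Finset.sum_congr rfl fun z _ => diagMoment_perm H p k hσ ω z
  rw [h, ← Measure.map_map (measurable_clusterTrace H p r k x) hm.measurable, hm.map_eq]

theorem indepFun_clusterTrace (P₀ : Measure ℝ) [IsProbabilityMeasure P₀] (r k : ℕ) {x y : X}
    (hxy : Disjoint (H.cluster r x) (H.cluster r y)) :
    IndepFun (clusterTrace H p r k x) (clusterTrace H p r k y) (law X P₀) := by
  classical
  have hind : iIndepFun (fun (z : X) (ω : X → ℝ) => ω z) (law X P₀) :=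
    iIndepFun_infinitePi (P := fun _ : X => P₀) (X := fun _ t => t) (by fun_prop)
  have hfin := hind.indepFun_finset _ _ hxy (fun z => measurable_pi_apply z)
  -- Extending by zero outside the cluster exhibits the trace as a measurable function of finitely
  -- many coordinates.
  let ext : ∀ w : X, (H.cluster r w → ℝ) → X → ℝ := fun w η z =>
    if h : z ∈ H.cluster r w then η ⟨z, h⟩ else 0
  have hext : ∀ w, Measurable (ext w) := by
    intro w
    refine measurable_pi_lambda _ fun z => ?_
    by_cases h : z ∈ H.cluster r w
    · simp only [ext, dif_pos h]
      exact measurable_pi_apply _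
    · simp only [ext, dif_neg h]
      exact measurable_const
  have hloc : ∀ w, clusterTrace H p r k w =
      (clusterTrace H p r k w ∘ ext w) ∘ fun ω z => ω z := by
    intro w
    funext ω
    refine Finset.sum_congr rfl fun z hz => diagMoment_congr H p k fun u hu => ?_
    rw [H.cluster_eq_of_mem hz] at hu
    simp [ext, hu]
  rw [hloc x, hloc y]
  exact hfin.comp ((measurable_clusterTrace H p r k x).comp (hext x))
    ((measurable_clusterTrace H p r k y).comp (hext y))

variable {p} (hp : ∀ s : ℕ, 1 ≤ s → 0 < p s ∧ p s < 1) (hsum : HasSum (fun s : ℕ => p (s + 1)) 1)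

include hp hsum in
theorem abs_diagMoment_le (r k : ℕ) {ω : X → ℝ} {C : ℝ} (hC : 0 ≤ C) (hω : ∀ x, |ω x| ≤ C)
    (x : X) : |diagMoment H p r k ω x| ≤ (1 + C) ^ k := by
  rw [diagMoment_eq H p r k ⟨C, hω⟩]
  exact (abs_re_apply_single_le _ x).trans
    (norm_pow_le_of_norm_le (norm_finiteRangeOp_le H hp hsum r hC hω) k)

include hp hsum in
theorem integrable_diagMoment (P₀ : Measure ℝ) [IsProbabilityMeasure P₀] {C : ℝ} (hC : 0 ≤ C)
    (hae : ∀ᵐ ω ∂(law X P₀), ∀ x, |ω x| ≤ C) (r k : ℕ) (x : X) :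
    Integrable (fun ω => diagMoment H p r k ω x) (law X P₀) := by
  have : IsProbabilityMeasure (law X P₀) := by unfold law; infer_instance
  refine Integrable.of_bound (measurable_diagMoment H p r k x).aestronglyMeasurable
    ((1 + C) ^ k) ?_
  filter_upwards [hae] with ω hω
  exact abs_diagMoment_le H hp hsum r k hC hω x

include hp hsum in
theorem ae_tendsto_average_diagMoment [Countable X] [Infinite X] (P₀ : Measure ℝ)
    [IsProbabilityMeasure P₀] {C : ℝ} (hC : 0 ≤ C) (hae : ∀ᵐ ω ∂(law X P₀), ∀ x, |ω x| ≤ C)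
    (x₀ : X) (r k : ℕ) :
    ∀ᵐ ω ∂(law X P₀), Filter.Tendsto
      (fun κ => ((H.cluster κ x₀).card : ℝ)⁻¹ * ∑ x ∈ H.cluster κ x₀, diagMoment H p r k ω x)
      Filter.atTop (nhds (∫ ω, diagMoment H p r k ω x₀ ∂(law X P₀))) := by
  classical
  obtain ⟨e, m, hdisj, hunion, hcard⟩ := H.exists_cluster_enumeration x₀ r
  have hint : Integrable (clusterTrace H p r k (e 0)) (law X P₀) :=
    integrable_finsetSum _ fun z _ => integrable_diagMoment H hp hsum P₀ hC hae r k z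
  have hmean : ∫ ω, clusterTrace H p r k (e 0) ω ∂(law X P₀) =
      (H.cluster r x₀).card * ∫ ω, diagMoment H p r k ω x₀ ∂(law X P₀) := by
    simp only [clusterTrace]
    rw [integral_finsetSum _ fun z _ => integrable_diagMoment H hp hsum P₀ hC hae r k z,
      Finset.sum_congr rfl fun z _ => (identDistrib_diagMoment H p P₀ r k x₀ z).integral_eq,
      Finset.sum_const, nsmul_eq_mul, H.card_cluster_eq r (e 0) x₀]
  -- Pairwise independence is enough for this form of the strong law.
  have hslln := strong_law_ae_real (fun i => clusterTrace H p r k (e i)) hint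
    (fun i j hij => indepFun_clusterTrace H p P₀ r k (hdisj i j hij))
    (fun i => identDistrib_clusterTrace H p P₀ r k _ _)
  have hN : (0 : ℝ) < (H.cluster r x₀).card := by exact_mod_cast H.card_cluster_pos r x₀
  have hm : Filter.Tendsto m Filter.atTop Filter.atTop := by
    have h1 : Filter.Tendsto (fun κ => m κ * (H.cluster r x₀).card) Filter.atTop Filter.atTop := by
      refine (H.tendsto_card_cluster x₀).congr' ?_
      filter_upwards [Filter.eventually_ge_atTop r] with κ hκ using hcard κ hκ
    exact Filter.Tendsto.atTop_of_mul_const₀ (H.card_cluster_pos r x₀) h1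
  filter_upwards [hslln] with ω hω
  rw [hmean] at hω
  -- The volumes `Q_κ` correspond to the partial sums of length `m κ`, and `m κ → ∞`.
  have h2 := (hω.comp hm).const_mul ((H.cluster r x₀).card : ℝ)⁻¹
  rw [inv_mul_cancel_left₀ hN.ne'] at h2
  refine h2.congr' ?_
  filter_upwards [Filter.eventually_ge_atTop r] with κ hκ
  have hset : H.cluster κ x₀ = (Finset.range (m κ)).biUnion fun i => H.cluster r (e i) := by
    rw [← Finset.coe_inj, hunion κ hκ, Finset.coe_biUnion]
    simp
  rw [hcard κ hκ, hset, Finset.sum_biUnion fun i _ j _ hij => hdisj i j hij]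
  simp only [Function.comp_apply, clusterTrace]
  push_cast
  rw [mul_inv, div_eq_mul_inv]
  ring

open Classical in
/-- The diagonal matrix element at `x` of the `k`-th power of the Hamiltonian. -/
def hamiltonianMoment (p : ℕ → ℝ) (k : ℕ) (x : X) (ω : X → ℝ) : ℝ :=
  ((hamiltonian H p ω ^ k) (lp.single 2 x (1 : ℂ)) x).re

include hp hsum in
theorem abs_hamiltonianMoment_sub_le (r k : ℕ) {ω : X → ℝ} {C : ℝ} (hC : 0 ≤ C)
    (hω : ∀ x, |ω x| ≤ C) (x : X) :
    |hamiltonianMoment H p k x ω - diagMoment H p r k ω x| ≤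
      k * (1 + C) ^ k * tailWeight p r := by
  rw [diagMoment_eq H p r k ⟨C, hω⟩]
  refine (abs_re_pow_apply_single_sub_le (by linarith) (norm_hamiltonian_le H hp hsum hC hω)
    (norm_finiteRangeOp_le H hp hsum r hC hω) k x).trans ?_
  gcongr
  exact norm_hamiltonian_sub_le H hp hsum r ω

include hp hsum in
theorem abs_diagMoment_shift_sub_le {r κ : ℕ} (hr : r ≤ κ) (k : ℕ) (b : Restriction) {ω : X → ℝ}
    {C : ℝ} (hC : 0 ≤ C) (hω : ∀ x, |ω x| ≤ C) (x : X) :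
    |diagMoment H p κ k (fun x => ω x + b.shift p κ) x - diagMoment H p r k ω x| ≤
      k * (1 + C) ^ k * tailWeight p r := by
  have hb : 0 ≤ b.shift p κ ∧ b.shift p κ ≤ tailWeight p κ := by
    cases b
    · exact ⟨le_rfl, tailWeight_nonneg hp κ⟩
    · exact ⟨tailWeight_nonneg hp κ, le_rfl⟩
  have hbd : ∃ C : ℝ, ∀ x, |ω x + b.shift p κ| ≤ C :=
    ⟨C + |b.shift p κ|, fun x => (abs_add_le _ _).trans (by gcongr; exact hω x)⟩
  rw [diagMoment_eq H p r k ⟨C, hω⟩, diagMoment_eq H p κ k hbd]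
  refine (abs_re_pow_apply_single_sub_le (by linarith)
    (norm_finiteRangeOp_add_const_le H hp hsum κ hC hω hb.1 hb.2)
    (norm_finiteRangeOp_le H hp hsum r hC hω) k x).trans ?_
  gcongr
  exact norm_finiteRangeOp_sub_le H hp hsum hr ⟨C, hω⟩ hb.1 hb.2

include hp hsum in
theorem tendsto_diagMoment (k : ℕ) {ω : X → ℝ} {C : ℝ} (hC : 0 ≤ C)
    (hω : ∀ x, |ω x| ≤ C) (x : X) :
    Filter.Tendsto (fun r => diagMoment H p r k ω x) Filter.atTop
      (nhds (hamiltonianMoment H p k x ω)) := by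
  rw [tendsto_iff_dist_tendsto_zero]
  refine squeeze_zero (fun _ => dist_nonneg) (fun r => ?_)
    (by simpa using (tendsto_tailWeight (p := p)).const_mul (k * (1 + C) ^ k))
  rw [dist_comm, Real.dist_eq]
  exact abs_hamiltonianMoment_sub_le H hp hsum r k hC hω x

include hp hsum in
-- A limit of functions of finitely many coordinates. The convergence is known on uniformly bounded
-- configurations, hence almost everywhere.
theorem aestronglyMeasurable_hamiltonianMoment (P₀ : Measure ℝ) [IsProbabilityMeasure P₀] {C : ℝ}
    (hC : 0 ≤ C) (hae : ∀ᵐ ω ∂(law X P₀), ∀ x, |ω x| ≤ C) (k : ℕ) (x : X) :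
    AEStronglyMeasurable (hamiltonianMoment H p k x) (law X P₀) := by
  refine aestronglyMeasurable_of_tendsto_ae Filter.atTop
    (fun r => (measurable_diagMoment H p r k x).aestronglyMeasurable) ?_
  filter_upwards [hae] with ω hω
  exact tendsto_diagMoment H hp hsum k hC hω x

include hp hsum in
theorem tendsto_integral_diagMoment (P₀ : Measure ℝ) [IsProbabilityMeasure P₀] {C : ℝ}
    (hC : 0 ≤ C) (hae : ∀ᵐ ω ∂(law X P₀), ∀ x, |ω x| ≤ C) (k : ℕ) (x : X) :
    Filter.Tendsto (fun r => ∫ ω, diagMoment H p r k ω x ∂(law X P₀)) Filter.atTop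
      (nhds (∫ ω, hamiltonianMoment H p k x ω ∂(law X P₀))) := by
  have : IsProbabilityMeasure (law X P₀) := by unfold law; infer_instance
  refine tendsto_integral_of_dominated_convergence (fun _ => (1 + C) ^ k)
    (fun r => (measurable_diagMoment H p r k x).aestronglyMeasurable) (integrable_const _)
    (fun r => ?_) ?_
  · filter_upwards [hae] with ω hω
    exact abs_diagMoment_le H hp hsum r k hC hω x
  · filter_upwards [hae] with ω hω
    exact tendsto_diagMoment H hp hsum k hC hω x

open Classical in
include hp hsum in
/-- The moments of the finite-volume eigenvalue distributions converge almost surely. -/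
theorem ae_tendsto_average_eigenvalues_pow [Countable X] [Infinite X] (P₀ : Measure ℝ)
    [IsProbabilityMeasure P₀] {C : ℝ} (hC : 0 ≤ C) (hae : ∀ᵐ ω ∂(law X P₀), ∀ x, |ω x| ≤ C)
    (x₀ : X) (b : Restriction) :
    ∀ᵐ ω ∂(law X P₀), ∀ k : ℕ, Filter.Tendsto
      (fun κ => ((H.cluster κ x₀).card : ℝ)⁻¹ *
        ∑ j, (isHermitian_hamiltonianMatrix H p x₀ κ b ω).eigenvalues j ^ k)
      Filter.atTop (nhds (∫ ω, hamiltonianMoment H p k x₀ ω ∂(law X P₀))) := by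
  -- Countably many pairs `(k, r)` leave a single null set.
  have hall : ∀ᵐ ω ∂(law X P₀), ∀ k r : ℕ, Filter.Tendsto
      (fun κ => ((H.cluster κ x₀).card : ℝ)⁻¹ * ∑ x ∈ H.cluster κ x₀, diagMoment H p r k ω x)
      Filter.atTop (nhds (∫ ω, diagMoment H p r k ω x₀ ∂(law X P₀))) :=
    ae_all_iff.2 fun k => ae_all_iff.2 fun r =>
      ae_tendsto_average_diagMoment H hp hsum P₀ hC hae x₀ r k
  filter_upwards [hall, hae] with ω hω hωC k
  simp only [sum_eigenvalues_pow]
  rw [Metric.tendsto_atTop']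
  intro ε hε
  -- The rank `r` is fixed before the volume grows: one third of `ε` covers the expected moments,
  -- one the truncation error, one the strong law at rank `r`.
  have h1 := Metric.tendsto_nhds.1 (tendsto_integral_diagMoment H hp hsum P₀ hC hae k x₀)
    (ε / 3) (by positivity)
  have h2 : Filter.Tendsto (fun r => k * (1 + C) ^ k * tailWeight p r) Filter.atTop (nhds 0) := by
    simpa using (tendsto_tailWeight (p := p)).const_mul (k * (1 + C) ^ k)
  have h3 := h2.eventually (gt_mem_nhds (show (0 : ℝ) < ε / 3 by positivity))
  obtain ⟨r, hr1, hr3⟩ := (h1.and h3).exists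
  have h4 := Metric.tendsto_nhds.1 (hω k r) (ε / 3) (by positivity)
  obtain ⟨N, hN⟩ := (h4.and (Filter.eventually_ge_atTop r)).exists_forall_of_atTop
  refine ⟨N, fun κ hκ => ?_⟩
  obtain ⟨h5, hrκ⟩ := hN κ hκ.le
  have hc : (0 : ℝ) < (H.cluster κ x₀).card := by exact_mod_cast H.card_cluster_pos κ x₀
  have h6 : |((H.cluster κ x₀).card : ℝ)⁻¹ * ∑ x ∈ H.cluster κ x₀,
      diagMoment H p κ k (fun x => ω x + b.shift p κ) x -
      ((H.cluster κ x₀).card : ℝ)⁻¹ * ∑ x ∈ H.cluster κ x₀, diagMoment H p r k ω x| ≤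
      k * (1 + C) ^ k * tailWeight p r := by
    rw [← mul_sub, ← Finset.sum_sub_distrib, abs_mul, abs_of_pos (inv_pos.2 hc), inv_mul_le_iff₀ hc]
    refine (Finset.abs_sum_le_sum_abs _ _).trans ((Finset.sum_le_sum fun x _ =>
      abs_diagMoment_shift_sub_le H hp hsum hrκ k b hC hωC x).trans_eq ?_)
    rw [Finset.sum_const, nsmul_eq_mul]
  rw [Real.dist_eq, abs_lt] at *
  rw [abs_le] at h6
  constructor <;> linarith [h6.1, h6.2, h5.1, h5.2, hr1.1, hr1.2]

end Probability

/-! ### Support, mass and moments of spectral measures. -/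

section SpectralMeasure

variable {E : Type*} [NormedAddCommGroup E] [InnerProductSpace ℂ E] [CompleteSpace E]

theorem spectrum_subset_Icc {T : E →L[ℂ] E} {R : ℝ} (hR : ‖T‖ ≤ R) :
    spectrum ℝ T ⊆ Set.Icc (-R) R := by
  intro t ht
  rcases subsingleton_or_nontrivial E with h | h
  · have : Subsingleton (E →L[ℂ] E) := inferInstance
    rw [spectrum.of_subsingleton] at ht
    exact absurd ht (Set.notMem_empty t)
  · have := spectrum.norm_le_norm_of_mem ht
    rw [Real.norm_eq_abs] at this
    exact Set.mem_Icc.2 (abs_le.1 (this.trans hR))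

/-- A continuous function multiplied by a cutoff which is `1` on `[-R, R]`. -/
def cutoff (R : ℝ) (f : C(ℝ, ℝ)) : C_c(ℝ, ℝ) where
  toFun t := f t * max 0 (min 1 (R + 1 - |t|))
  hasCompactSupport' := by
    refine HasCompactSupport.intro (isCompact_Icc (a := -(R + 1)) (b := R + 1)) fun t ht => ?_
    have : R + 1 < |t| := by
      by_contra h
      exact ht (abs_le.1 (not_lt.1 h))
    rw [max_eq_left ((min_le_right _ _).trans (by linarith)), mul_zero]

theorem cutoff_eq (R : ℝ) (f : C(ℝ, ℝ)) {t : ℝ} (ht : t ∈ Set.Icc (-R) R) : cutoff R f t = f t := by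
  have : |t| ≤ R := abs_le.2 ht
  change f t * max 0 (min 1 (R + 1 - |t|)) = f t
  rw [min_eq_left (by linarith), max_eq_right zero_le_one, mul_one]

theorem cfc_cutoff {T : E →L[ℂ] E} {R : ℝ} (hR : ‖T‖ ≤ R) (f : C(ℝ, ℝ)) :
    cfc (cutoff R f : ℝ → ℝ) T = cfc f T :=
  cfc_congr fun _ ht => cutoff_eq R f (spectrum_subset_Icc hR ht)

/-- A nonnegative function that vanishes on `[-R, R]`, hence on the spectrum, and is positive
elsewhere has integral zero. The Riesz measure is tested on compactly supported functions only, so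
the function is cut off at every integer `n`. -/
theorem ae_spectralMeasure_mem_Icc {T : E →L[ℂ] E} (ψ : E) {R : ℝ} (hR : ‖T‖ ≤ R) :
    ∀ᵐ t ∂(spectralMeasure T ψ), t ∈ Set.Icc (-R) R := by
  let g : C(ℝ, ℝ) := ⟨fun t => max 0 (|t| - R), by fun_prop⟩
  have hg : ∀ t ∈ Set.Icc (-R) R, g t = 0 := fun t ht => by
    have : |t| ≤ R := abs_le.2 ht
    exact max_eq_left (by linarith)
  have hreg : (spectralMeasure T ψ).Regular := by unfold spectralMeasure; infer_instance
  have key : ∀ n : ℕ, ∀ᵐ t ∂(spectralMeasure T ψ), cutoff n g t = 0 := by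
    intro n
    have h0 : ∫ t, cutoff n g t ∂(spectralMeasure T ψ) = 0 := by
      rw [integral_spectralMeasure]
      have : cfc (cutoff n g : ℝ → ℝ) T = cfc (0 : ℝ → ℝ) T := by
        refine cfc_congr fun t ht => ?_
        change g t * _ = 0
        rw [hg t (spectrum_subset_Icc hR ht), zero_mul]
      rw [this, cfc_zero]
      simp
    have hint : Integrable (cutoff n g) (spectralMeasure T ψ) :=
      (cutoff n g).continuous.integrable_of_hasCompactSupport (cutoff n g).hasCompactSupport
    exact (integral_eq_zero_iff_of_nonneg
      (fun t => mul_nonneg (le_max_left _ _) (le_max_left _ _)) hint).1 h0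
  filter_upwards [ae_all_iff.2 key] with t ht
  obtain ⟨n, hn⟩ := exists_nat_ge |t|
  have h1 := ht n
  rw [cutoff_eq _ _ (abs_le.1 hn)] at h1
  have h2 : |t| - R ≤ 0 := h1 ▸ le_max_right 0 (|t| - R)
  exact abs_le.1 (by linarith)

theorem isFiniteMeasure_spectralMeasure (T : E →L[ℂ] E) (ψ : E) :
    IsFiniteMeasure (spectralMeasure T ψ) := by
  have hreg : (spectralMeasure T ψ).Regular := by unfold spectralMeasure; infer_instance
  refine ⟨?_⟩
  have h : spectralMeasure T ψ Set.univ = spectralMeasure T ψ (Set.Icc (-‖T‖) ‖T‖) :=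
    (measure_eq_measure_of_null_sdiff (Set.subset_univ _) (by
      rw [← Set.compl_eq_univ_sdiff]
      exact ae_spectralMeasure_mem_Icc ψ le_rfl)).symm
  rw [h]
  exact isCompact_Icc.measure_lt_top

theorem integral_spectralMeasure_continuous (T : E →L[ℂ] E) (ψ : E) (f : C(ℝ, ℝ)) :
    ∫ t, f t ∂(spectralMeasure T ψ) = (inner ℂ ψ (cfc f T ψ)).re := by
  rw [← cfc_cutoff le_rfl f, ← integral_spectralMeasure]
  refine integral_congr_ae ?_
  filter_upwards [ae_spectralMeasure_mem_Icc ψ (le_refl ‖T‖)] with t ht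
  exact (cutoff_eq _ _ ht).symm

theorem integral_pow_spectralMeasure {T : E →L[ℂ] E} (hT : IsSelfAdjoint T) (ψ : E) (k : ℕ) :
    ∫ t, t ^ k ∂(spectralMeasure T ψ) = (inner ℂ ψ ((T ^ k) ψ)).re := by
  have h := integral_spectralMeasure_continuous T ψ ⟨fun t => t ^ k, by fun_prop⟩
  simp only [ContinuousMap.coe_mk] at h
  rw [h, cfc_pow_id T k hT]

theorem isProbabilityMeasure_spectralMeasure {T : E →L[ℂ] E} (hT : IsSelfAdjoint T) {ψ : E}
    (hψ : ‖ψ‖ = 1) : IsProbabilityMeasure (spectralMeasure T ψ) := by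
  have := isFiniteMeasure_spectralMeasure T ψ
  have h := integral_pow_spectralMeasure hT ψ 0
  simp only [pow_zero, integral_const, smul_eq_mul, mul_one, one_apply_eq_self] at h
  rw [inner_self_eq_norm_sq_to_K, hψ] at h
  refine ⟨?_⟩
  have h1 : (spectralMeasure T ψ).real Set.univ = 1 := by simpa using h
  rw [Measure.real, ENNReal.toReal_eq_one_iff] at h1
  exact h1

end SpectralMeasure

/-! ### From convergence of moments to convergence of distribution functions. -/

section Moments

open Filter Topology

/-- The continuous function that is `1` on `]-∞, a]`, `0` on `[b, ∞[` and affine in between. -/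
def ramp (a b : ℝ) : C(ℝ, ℝ) := ⟨fun t => max 0 (min 1 ((b - t) / (b - a))), by fun_prop⟩

theorem ramp_nonneg (a b t : ℝ) : 0 ≤ ramp a b t := le_max_left _ _

theorem ramp_le_one (a b t : ℝ) : ramp a b t ≤ 1 := max_le zero_le_one (min_le_left _ _)

theorem ramp_of_le {a b t : ℝ} (hab : a < b) (ht : t ≤ a) : ramp a b t = 1 := by
  change max 0 (min 1 ((b - t) / (b - a))) = 1
  rw [min_eq_left ((one_le_div (by linarith)).2 (by linarith)), max_eq_right zero_le_one]

theorem ramp_of_ge {a b t : ℝ} (hab : a < b) (ht : b ≤ t) : ramp a b t = 0 :=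
  max_eq_left ((min_le_right _ _).trans (div_nonpos_of_nonpos_of_nonneg (by linarith) (by linarith)))

theorem indicator_le_ramp {a b : ℝ} (hab : a < b) (t : ℝ) :
    (Set.Iic a).indicator 1 t ≤ ramp a b t := by
  by_cases h : t ≤ a
  · rw [ramp_of_le hab h]
    exact Set.indicator_le_self' (fun _ _ => zero_le_one) t
  · rw [Set.indicator_of_notMem (by simpa using h)]
    exact ramp_nonneg a b t

theorem ramp_le_indicator {a b : ℝ} (hab : a < b) (t : ℝ) :
    ramp a b t ≤ (Set.Iic b).indicator 1 t := by
  by_cases h : t ≤ b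
  · rw [Set.indicator_of_mem (by simpa using h)]
    exact ramp_le_one a b t
  · rw [ramp_of_ge hab (not_le.1 h).le]
    exact Set.indicator_nonneg (fun _ _ => zero_le_one) t

variable {Ω : Type*} [MeasurableSpace Ω] {P : Measure Ω} [IsProbabilityMeasure P]
  {μ : Ω → Measure ℝ} {R : ℝ}

theorem integrable_of_continuous_of_ae_mem_Icc {ν : Measure ℝ} [IsFiniteMeasure ν]
    (hν : ∀ᵐ t ∂ν, t ∈ Set.Icc (-R) R) {f : ℝ → ℝ} (hf : Continuous f) : Integrable f ν := by
  obtain ⟨C, hC⟩ := isCompact_Icc.exists_bound_of_continuousOn (hf.continuousOn (s := Set.Icc (-R) R))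
  refine Integrable.of_bound hf.aestronglyMeasurable C ?_
  filter_upwards [hν] with t ht using hC t ht

theorem abs_integral_sub_le {ν : Measure ℝ} [IsProbabilityMeasure ν]
    (hν : ∀ᵐ t ∂ν, t ∈ Set.Icc (-R) R) {f g : ℝ → ℝ} (hf : Continuous f) (hg : Continuous g)
    {ε : ℝ} (h : ∀ t ∈ Set.Icc (-R) R, |f t - g t| ≤ ε) :
    |∫ t, f t ∂ν - ∫ t, g t ∂ν| ≤ ε := by
  rw [← integral_sub (integrable_of_continuous_of_ae_mem_Icc hν hf)
    (integrable_of_continuous_of_ae_mem_Icc hν hg)]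
  have := norm_integral_le_of_norm_le_const (μ := ν) (f := fun t => f t - g t) (C := ε) (by
    filter_upwards [hν] with t ht using h t ht)
  simpa using this

variable (hμ : ∀ᵐ ω ∂P, IsProbabilityMeasure (μ ω) ∧ ∀ᵐ t ∂(μ ω), t ∈ Set.Icc (-R) R)
  (hmeas : ∀ k : ℕ, AEStronglyMeasurable (fun ω => ∫ t, t ^ k ∂(μ ω)) P)

omit [IsProbabilityMeasure P] in
include hμ hmeas in
theorem aestronglyMeasurable_integral_polynomial (q : Polynomial ℝ) :
    AEStronglyMeasurable (fun ω => ∫ t, q.eval t ∂(μ ω)) P := by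
  have h : AEStronglyMeasurable (fun ω => ∑ k ∈ q.support, q.coeff k * ∫ t, t ^ k ∂(μ ω)) P :=
    Finset.aestronglyMeasurable_fun_sum _ fun k _ => (hmeas k).const_mul _
  refine h.congr ?_
  filter_upwards [hμ] with ω hω
  have := hω.1
  simp only [Polynomial.eval_eq_sum, Polynomial.sum]
  rw [integral_finsetSum _ fun k _ => integrable_of_continuous_of_ae_mem_Icc hω.2 (by fun_prop)]
  exact Finset.sum_congr rfl fun k _ => (integral_const_mul _ _).symm

omit [IsProbabilityMeasure P] in
include hμ hmeas in
-- Uniform polynomial approximation on `[-R, R]` passes measurability from the moments to all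
-- continuous functions.
theorem aestronglyMeasurable_integral_continuous {f : ℝ → ℝ} (hf : Continuous f) :
    AEStronglyMeasurable (fun ω => ∫ t, f t ∂(μ ω)) P := by
  have h := fun n : ℕ => exists_polynomial_near_of_continuousOn (-R) R f hf.continuousOn
    (1 / (n + 1 : ℝ)) (by positivity)
  choose q hq using h
  refine aestronglyMeasurable_of_tendsto_ae atTop
    (fun n => aestronglyMeasurable_integral_polynomial hμ hmeas (q n)) ?_
  filter_upwards [hμ] with ω hω
  have := hω.1
  rw [tendsto_iff_dist_tendsto_zero]
  exact squeeze_zero (fun _ => dist_nonneg) (fun n => abs_integral_sub_le hω.2 (q n).continuous hf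
    fun t ht => (hq n t ht).le) tendsto_one_div_add_atTop_nhds_zero_nat

include hμ hmeas in
theorem integrable_integral_continuous {f : ℝ → ℝ} (hf : Continuous f) :
    Integrable (fun ω => ∫ t, f t ∂(μ ω)) P := by
  obtain ⟨C, hC⟩ := isCompact_Icc.exists_bound_of_continuousOn (hf.continuousOn (s := Set.Icc (-R) R))
  refine Integrable.of_bound (aestronglyMeasurable_integral_continuous hμ hmeas hf) C ?_
  filter_upwards [hμ] with ω hω
  have := hω.1
  simpa using norm_integral_le_of_norm_le_const (μ := μ ω) (f := f) (C := C) (by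
    filter_upwards [hω.2] with t ht using hC t ht)

include hμ hmeas in
-- The indicator is a pointwise limit of ramps, so measurability comes from continuous functions;
-- the later comparison of expectations needs this integrability.
theorem integrable_measureReal_Iic (a : ℝ) : Integrable (fun ω => (μ ω).real (Set.Iic a)) P := by
  have hpos : ∀ n : ℕ, a < a + 1 / (n + 1 : ℝ) := fun n => by
    have : (0 : ℝ) < 1 / (n + 1 : ℝ) := by positivity
    linarith
  refine Integrable.of_bound (C := 1) ?_ ?_
  · refine aestronglyMeasurable_of_tendsto_ae atTop (fun n : ℕ =>
      aestronglyMeasurable_integral_continuous hμ hmeas (ramp a (a + 1 / (n + 1 : ℝ))).continuous) ?_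
    filter_upwards [hμ] with ω hω
    have := hω.1
    rw [← integral_indicator_one measurableSet_Iic]
    refine tendsto_integral_of_dominated_convergence (fun _ => 1)
      (fun n => (ramp _ _).continuous.aestronglyMeasurable) (integrable_const _)
      (fun n => Eventually.of_forall fun t => ?_) (Eventually.of_forall fun t => ?_)
    · rw [Real.norm_of_nonneg (ramp_nonneg _ _ _)]
      exact ramp_le_one _ _ _
    · by_cases h : t ≤ a
      · rw [Set.indicator_of_mem (by simpa using h)]
        exact tendsto_const_nhds.congr fun n => (ramp_of_le (hpos n) h).symm
      · rw [Set.indicator_of_notMem (by simpa using h)]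
        refine tendsto_const_nhds.congr' ?_
        have hlim : Tendsto (fun n : ℕ => a + 1 / (n + 1 : ℝ)) atTop (𝓝 (a + 0)) :=
          tendsto_const_nhds.add tendsto_one_div_add_atTop_nhds_zero_nat
        rw [add_zero] at hlim
        filter_upwards [hlim.eventually (gt_mem_nhds (not_le.1 h))] with n hn
        exact (ramp_of_ge (hpos n) hn.le).symm
  · filter_upwards [hμ] with ω hω
    have := hω.1
    rw [Real.norm_of_nonneg measureReal_nonneg]
    exact measureReal_le_one

variable {Λ : ℕ → (ℝ → ℝ) →ₗ[ℝ] ℝ} (hΛ1 : ∀ n, Λ n 1 = 1)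
  (hΛmono : ∀ n f g, (∀ t ∈ Set.Icc (-R) R, f t ≤ g t) → Λ n f ≤ Λ n g)
  (hΛ : ∀ k : ℕ, Tendsto (fun n => Λ n fun t => t ^ k) atTop (𝓝 (∫ ω, ∫ t, t ^ k ∂(μ ω) ∂P)))

include hμ hmeas hΛ in
theorem tendsto_polynomial_of_tendsto_moments (q : Polynomial ℝ) :
    Tendsto (fun n => Λ n fun t => q.eval t) atTop (𝓝 (∫ ω, ∫ t, q.eval t ∂(μ ω) ∂P)) := by
  have h1 : ∫ ω, ∫ t, q.eval t ∂(μ ω) ∂P =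
      ∑ k ∈ q.support, q.coeff k * ∫ ω, ∫ t, t ^ k ∂(μ ω) ∂P := by
    simp only [← integral_const_mul]
    rw [← integral_finsetSum _ fun k _ =>
      integrable_integral_continuous hμ hmeas (f := fun t => q.coeff k * t ^ k) (by fun_prop)]
    refine integral_congr_ae ?_
    filter_upwards [hμ] with ω hω
    have := hω.1
    simp only [Polynomial.eval_eq_sum, Polynomial.sum]
    rw [integral_finsetSum _ fun k _ => integrable_of_continuous_of_ae_mem_Icc hω.2 (by fun_prop)]
  have h2 : ∀ n, Λ n (fun t => q.eval t) = ∑ k ∈ q.support, q.coeff k * Λ n fun t => t ^ k := by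
    intro n
    have : (fun t => q.eval t) = ∑ k ∈ q.support, q.coeff k • fun t : ℝ => t ^ k := by
      ext t
      simp [Polynomial.eval_eq_sum, Polynomial.sum]
    rw [this, map_sum]
    simp only [map_smul, smul_eq_mul]
  rw [h1]
  simp only [h2]
  exact tendsto_finsetSum _ fun k _ => (hΛ k).const_mul _

include hμ hmeas hΛ1 hΛmono hΛ in
-- Normalisation and monotonicity make each `Λ n` a contraction for the supremum norm on `[-R, R]`,
-- so a polynomial `ε / 4`-close to `f` costs `ε / 4` on either side of the limit.
theorem tendsto_continuous_of_tendsto_moments {f : ℝ → ℝ} (hf : Continuous f) :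
    Tendsto (fun n => Λ n f) atTop (𝓝 (∫ ω, ∫ t, f t ∂(μ ω) ∂P)) := by
  rw [Metric.tendsto_nhds]
  intro ε hε
  obtain ⟨q, hq⟩ := exists_polynomial_near_of_continuousOn (-R) R f hf.continuousOn (ε / 4)
    (by positivity)
  have h1 : |∫ ω, ∫ t, q.eval t ∂(μ ω) ∂P - ∫ ω, ∫ t, f t ∂(μ ω) ∂P| ≤ ε / 4 := by
    rw [← integral_sub (integrable_integral_continuous hμ hmeas q.continuous)
      (integrable_integral_continuous hμ hmeas hf)]
    have := norm_integral_le_of_norm_le_const (μ := P) (C := ε / 4)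
      (f := fun ω => ∫ t, q.eval t ∂(μ ω) - ∫ t, f t ∂(μ ω)) (by
        filter_upwards [hμ] with ω hω
        have := hω.1
        exact abs_integral_sub_le hω.2 q.continuous hf fun t ht => (hq t ht).le)
    simpa using this
  have h2 : ∀ n, |Λ n (fun t => q.eval t) - Λ n f| ≤ ε / 4 := by
    intro n
    have hc : Λ n (fun _ => ε / 4) = ε / 4 := by
      have : (fun _ : ℝ => ε / 4) = (ε / 4) • (1 : ℝ → ℝ) := by
        ext t
        simp
      rw [this, map_smul, hΛ1, smul_eq_mul, mul_one]
    rw [← map_sub, abs_le]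
    constructor
    · rw [← hc, ← map_neg]
      exact hΛmono n _ _ fun t ht => (abs_lt.1 (hq t ht)).1.le
    · conv_rhs => rw [← hc]
      exact hΛmono n _ _ fun t ht => (abs_lt.1 (hq t ht)).2.le
  filter_upwards [Metric.tendsto_nhds.1
    (tendsto_polynomial_of_tendsto_moments hμ hmeas hΛ q) (ε / 4) (by positivity)] with n hn
  have h3 := h2 n
  rw [Real.dist_eq, abs_lt] at *
  rw [abs_le] at h1 h3
  constructor <;> linarith [h1.1, h1.2, h3.1, h3.2, hn.1, hn.2]

include hμ hmeas hΛ1 hΛmono hΛ in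
/-- Convergence of moments to those of an averaged compactly supported distribution implies
convergence of the distribution functions at continuity points of the limit. -/
theorem tendsto_cdf_of_tendsto_moments {a : ℝ}
    (ha : ContinuousAt (fun a => ∫ ω, (μ ω).real (Set.Iic a) ∂P) a) :
    Tendsto (fun n => Λ n ((Set.Iic a).indicator 1)) atTop
      (𝓝 (∫ ω, (μ ω).real (Set.Iic a) ∂P)) := by
  rw [Metric.tendsto_nhds]
  intro ε hε
  -- Ramps on either side of `a`, of width `δ / 2`, bracket the indicator. Continuity at `a`
  -- controls the mass that they pick up.
  obtain ⟨δ, hδ, hδε⟩ := Metric.continuousAt_iff.1 ha (ε / 2) (by positivity)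
  have hup := hδε (x := a + δ / 2) (by rw [Real.dist_eq, add_sub_cancel_left, abs_of_pos] <;> linarith)
  have hlo := hδε (x := a - δ / 2) (by
    rw [Real.dist_eq, sub_sub_cancel_left, abs_neg, abs_of_pos] <;> linarith)
  have hab : a < a + δ / 2 := by linarith
  have hba : a - δ / 2 < a := by linarith
  have hupi : ∫ ω, ∫ t, ramp a (a + δ / 2) t ∂(μ ω) ∂P ≤
      ∫ ω, (μ ω).real (Set.Iic (a + δ / 2)) ∂P := by
    refine integral_mono_ae (integrable_integral_continuous hμ hmeas (ramp _ _).continuous)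
      (integrable_measureReal_Iic hμ hmeas _) ?_
    filter_upwards [hμ] with ω hω
    have := hω.1
    rw [← integral_indicator_one measurableSet_Iic]
    exact integral_mono (integrable_of_continuous_of_ae_mem_Icc hω.2 (ramp _ _).continuous)
      ((integrable_const 1).indicator measurableSet_Iic) (ramp_le_indicator hab)
  have hloi : ∫ ω, (μ ω).real (Set.Iic (a - δ / 2)) ∂P ≤
      ∫ ω, ∫ t, ramp (a - δ / 2) a t ∂(μ ω) ∂P := by
    refine integral_mono_ae (integrable_measureReal_Iic hμ hmeas _)
      (integrable_integral_continuous hμ hmeas (ramp _ _).continuous) ?_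
    filter_upwards [hμ] with ω hω
    have := hω.1
    rw [← integral_indicator_one measurableSet_Iic]
    exact integral_mono ((integrable_const 1).indicator measurableSet_Iic)
      (integrable_of_continuous_of_ae_mem_Icc hω.2 (ramp _ _).continuous) (indicator_le_ramp hba)
  filter_upwards [Metric.tendsto_nhds.1 (tendsto_continuous_of_tendsto_moments hμ hmeas hΛ1 hΛmono
    hΛ (ramp a (a + δ / 2)).continuous) (ε / 2) (by positivity),
    Metric.tendsto_nhds.1 (tendsto_continuous_of_tendsto_moments hμ hmeas hΛ1 hΛmono
    hΛ (ramp (a - δ / 2) a).continuous) (ε / 2) (by positivity)] with n h1 h2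
  have h3 := hΛmono n _ _ fun t _ => indicator_le_ramp hab t
  have h4 := hΛmono n _ _ fun t _ => ramp_le_indicator hba t
  rw [Real.dist_eq, abs_lt] at *
  constructor <;> linarith [h1.1, h1.2, h2.1, h2.2, hup.1, hup.2, hlo.1, hlo.2]

end Moments

/-! ### Self-adjointness of the Hamiltonian. -/

section SelfAdjoint

variable {X : Type*} (H : HierarchicalStructure X)

open Classical in
-- A bounded operator on `ℓ²(X)` is determined by its matrix elements, and taking the adjoint
-- conjugate-transposes them.
theorem isSelfAdjoint_of_apply_single {T : L2 X →L[ℂ] L2 X}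
    (hT : ∀ x y, star (T (lp.single 2 x (1 : ℂ)) y) = T (lp.single 2 y (1 : ℂ)) x) :
    IsSelfAdjoint T := by
  have hentry : ∀ (S : L2 X →L[ℂ] L2 X) x y,
      (star S) (lp.single 2 y (1 : ℂ)) x = star (S (lp.single 2 x (1 : ℂ)) y) := by
    intro S x y
    have h1 := lp.inner_single_left (𝕜 := ℂ) x (1 : ℂ) (star S (lp.single 2 y (1 : ℂ)))
    have h2 := lp.inner_single_right (𝕜 := ℂ) y (1 : ℂ) (S (lp.single 2 x (1 : ℂ)))
    rw [ContinuousLinearMap.star_eq_adjoint] at *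
    rw [ContinuousLinearMap.adjoint_inner_right, h2] at h1
    simpa using h1.symm
  refine lp.ext_continuousLinearMap (by norm_num) fun y => ?_
  ext x
  simp only [ContinuousLinearMap.comp_apply, lp.singleContinuousLinearMap_apply]
  exact (hentry T x y).trans (hT x y)

open Classical in
theorem isSelfAdjoint_averaging (s : ℕ) : IsSelfAdjoint (H.averaging s) := by
  refine isSelfAdjoint_of_apply_single fun x y => ?_
  rw [H.averaging_apply, H.averaging_apply]
  simp only [lp.coeFn_single, Pi.single_apply, Finset.sum_ite_eq']
  by_cases h : x ∈ H.cluster s y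
  · rw [if_pos h, if_pos (H.mem_cluster_comm.1 h), H.cluster_eq_of_mem h]
    simp
  · rw [if_neg h, if_neg fun h' => h (H.mem_cluster_comm.1 h')]
    simp

open Classical in
theorem isSelfAdjoint_potential {ω : X → ℝ} (hω : ∃ C : ℝ, ∀ x, |ω x| ≤ C) :
    IsSelfAdjoint (potential ω) := by
  refine isSelfAdjoint_of_apply_single fun x y => ?_
  rw [potential_apply ω hω, potential_apply ω hω]
  simp only [lp.coeFn_single, Pi.single_apply]
  by_cases h : x = y
  · subst h
    simp
  · simp [h, Ne.symm h]

/-- The self-adjoint operators are norm closed, and the truncations converge in norm. -/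
theorem isSelfAdjoint_hamiltonian {p : ℕ → ℝ} (hp : ∀ s : ℕ, 1 ≤ s → 0 < p s ∧ p s < 1)
    (hsum : HasSum (fun s : ℕ => p (s + 1)) 1) {ω : X → ℝ} (hω : ∃ C : ℝ, ∀ x, |ω x| ≤ C) :
    IsSelfAdjoint (hamiltonian H p ω) := by
  have hfin : ∀ r, IsSelfAdjoint (finiteRangeOp H p r ω) := fun r =>
    (isSelfAdjoint_sum _ fun s _ => IsSelfAdjoint.smul (Complex.conj_ofReal (p s))
      (isSelfAdjoint_averaging H s)).add (isSelfAdjoint_potential hω)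
  have hlim : Filter.Tendsto (fun r => finiteRangeOp H p r ω) Filter.atTop
      (nhds (hamiltonian H p ω)) := by
    rw [tendsto_iff_norm_sub_tendsto_zero]
    refine squeeze_zero (fun _ => norm_nonneg _) (fun r => ?_) (tendsto_tailWeight (p := p))
    rw [norm_sub_rev]
    exact norm_hamiltonian_sub_le H hp hsum r ω
  exact (isClosed_eq continuous_star continuous_id).mem_of_tendsto hlim
    (Filter.Eventually.of_forall hfin)

end SelfAdjoint

/-! ### Finite-volume eigenvalues and their averages. -/

section FiniteVolume

variable {X : Type*} (H : HierarchicalStructure X) {p : ℕ → ℝ}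

/-- The factor `N` is independent of `k`, whereas `(a / R) ^ (2 * k)` is unbounded when `|a| > R`.
-/
theorem abs_le_of_forall_pow_le {a N R : ℝ} (hR : 0 < R)
    (h : ∀ k : ℕ, a ^ (2 * k) ≤ N * R ^ (2 * k)) : |a| ≤ R := by
  by_contra hlt
  rw [not_le] at hlt
  obtain ⟨k, hk⟩ := pow_unbounded_of_one_lt N (show 1 < (a / R) ^ 2 by
    rw [one_lt_sq_iff_one_lt_abs, abs_div, abs_of_pos hR]
    exact (one_lt_div hR).2 hlt)
  rw [← pow_mul, div_pow, lt_div_iff₀ (by positivity)] at hk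
  exact absurd (h k) (not_le.2 hk)

open Classical in
-- The bound is read off from traces of even powers: one eigenvalue power is at most the trace,
-- which is at most `|Q_κ|` times a power of `1 + C`.
theorem eigenvalues_mem_Icc (hp : ∀ s : ℕ, 1 ≤ s → 0 < p s ∧ p s < 1)
    (hsum : HasSum (fun s : ℕ => p (s + 1)) 1) {ω : X → ℝ} {C : ℝ} (hC : 0 ≤ C)
    (hω : ∀ x, |ω x| ≤ C) (x₀ : X) (κ : ℕ) (b : Restriction) (j : H.cluster κ x₀) :
    (isHermitian_hamiltonianMatrix H p x₀ κ b ω).eigenvalues j ∈ Set.Icc (-(1 + C)) (1 + C) := by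
  have hb : 0 ≤ b.shift p κ ∧ b.shift p κ ≤ tailWeight p κ := by
    cases b
    · exact ⟨le_rfl, tailWeight_nonneg hp κ⟩
    · exact ⟨tailWeight_nonneg hp κ, le_rfl⟩
  have hbd : ∃ C : ℝ, ∀ x, |ω x + b.shift p κ| ≤ C :=
    ⟨C + |b.shift p κ|, fun x => (abs_add_le _ _).trans (by gcongr; exact hω x)⟩
  refine abs_le.1 (abs_le_of_forall_pow_le (N := (H.cluster κ x₀).card) (by linarith) fun k => ?_)
  calc (isHermitian_hamiltonianMatrix H p x₀ κ b ω).eigenvalues j ^ (2 * k)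
      ≤ ∑ i, (isHermitian_hamiltonianMatrix H p x₀ κ b ω).eigenvalues i ^ (2 * k) :=
        Finset.single_le_sum (f := fun i =>
          (isHermitian_hamiltonianMatrix H p x₀ κ b ω).eigenvalues i ^ (2 * k))
          (fun i _ => (even_two_mul k).pow_nonneg _) (Finset.mem_univ j)
    _ = ∑ x ∈ H.cluster κ x₀, diagMoment H p κ (2 * k) (fun x => ω x + b.shift p κ) x :=
        sum_eigenvalues_pow H p x₀ κ (2 * k) b ω
    _ ≤ ∑ x ∈ H.cluster κ x₀, (1 + C) ^ (2 * k) := by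
        refine Finset.sum_le_sum fun x _ => ?_
        rw [diagMoment_eq H p κ (2 * k) hbd]
        exact (le_abs_self _).trans ((abs_re_apply_single_le _ x).trans (norm_pow_le_of_norm_le
          (norm_finiteRangeOp_add_const_le H hp hsum κ hC hω hb.1 hb.2) _))
    _ = _ := by rw [Finset.sum_const, nsmul_eq_mul]

open Classical in
/-- The average of a function over the eigenvalues of the finite-volume Hamiltonian. -/
def eigenvalueAverage (p : ℕ → ℝ) (x₀ : X) (b : Restriction) (ω : X → ℝ) (κ : ℕ) :
    (ℝ → ℝ) →ₗ[ℝ] ℝ where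
  toFun f := ((H.cluster κ x₀).card : ℝ)⁻¹ *
    ∑ j, f ((isHermitian_hamiltonianMatrix H p x₀ κ b ω).eigenvalues j)
  map_add' f g := by simp only [Pi.add_apply, Finset.sum_add_distrib, mul_add]
  map_smul' c f := by
    simp only [Pi.smul_apply, smul_eq_mul, ← Finset.mul_sum, RingHom.id_apply]
    ring

theorem eigenvalueAverage_one (x₀ : X) (b : Restriction) (ω : X → ℝ) (κ : ℕ) :
    eigenvalueAverage H p x₀ b ω κ 1 = 1 := by
  have hc : ((H.cluster κ x₀).card : ℝ) ≠ 0 := by exact_mod_cast (H.card_cluster_pos κ x₀).ne'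
  simp [eigenvalueAverage, hc]

theorem eigenvalueAverage_mono (hp : ∀ s : ℕ, 1 ≤ s → 0 < p s ∧ p s < 1)
    (hsum : HasSum (fun s : ℕ => p (s + 1)) 1) {ω : X → ℝ} {C : ℝ} (hC : 0 ≤ C)
    (hω : ∀ x, |ω x| ≤ C) (x₀ : X) (b : Restriction) (κ : ℕ) (f g : ℝ → ℝ)
    (hfg : ∀ t ∈ Set.Icc (-(1 + C)) (1 + C), f t ≤ g t) :
    eigenvalueAverage H p x₀ b ω κ f ≤ eigenvalueAverage H p x₀ b ω κ g :=
  mul_le_mul_of_nonneg_left (Finset.sum_le_sum fun j _ =>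
    hfg _ (eigenvalues_mem_Icc H hp hsum hC hω x₀ κ b j)) (by positivity)

end FiniteVolume

/-! ### Moments of the spectral measure of the Hamiltonian. -/

section InfiniteVolume

variable {X : Type*} (H : HierarchicalStructure X) {p : ℕ → ℝ}

open Classical in
theorem integral_pow_spectralMeasure_hamiltonian (hp : ∀ s : ℕ, 1 ≤ s → 0 < p s ∧ p s < 1)
    (hsum : HasSum (fun s : ℕ => p (s + 1)) 1) {ω : X → ℝ} (hω : ∃ C : ℝ, ∀ x, |ω x| ≤ C)
    (x : X) (k : ℕ) :
    ∫ t, t ^ k ∂(spectralMeasure (hamiltonian H p ω) (lp.single 2 x (1 : ℂ))) =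
      hamiltonianMoment H p k x ω := by
  rw [integral_pow_spectralMeasure (isSelfAdjoint_hamiltonian H hp hsum hω),
    lp.inner_single_left, hamiltonianMoment]
  simp

end InfiniteVolume

end HierarchicalAnderson
end

/-! ### Almost sure convergence to the integrated density of states. -/

open HierarchicalAnderson MeasureTheory Filter Topology in
theorem lemma3p2 {X : Type*} [Countable X] [Infinite X] (H : HierarchicalStructure X)
    (p : ℕ → ℝ) (hp : ∀ s : ℕ, 1 ≤ s → 0 < p s ∧ p s < 1)
    (hsum : HasSum (fun s : ℕ => p (s + 1)) 1)
    (P₀ : Measure ℝ) [IsProbabilityMeasure P₀] (vmin vmax : ℝ)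
    (hsupp : P₀.support ⊆ Set.Icc vmin vmax) (x₀ : X) (b : Restriction) :
    ∃ Ω₀ : Set (X → ℝ), MeasurableSet Ω₀ ∧ law X P₀ Ω₀ = 1 ∧
      ∀ ω ∈ Ω₀, ∀ E : ℝ, ContinuousAt (ids H p P₀ x₀) E →
        Tendsto (fun κ : ℕ => countingFunction H p x₀ κ b ω E) atTop (𝓝 (ids H p P₀ x₀ E)) := by
  classical
  have hprob : IsProbabilityMeasure (law X P₀) := by unfold law; infer_instance
  obtain ⟨C, hC, hae⟩ : ∃ C : ℝ, 0 ≤ C ∧ ∀ᵐ ω ∂(law X P₀), ∀ x, |ω x| ≤ C := by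
    refine ⟨max |vmin| |vmax|, (abs_nonneg _).trans (le_max_left _ _), ?_⟩
    filter_upwards [ae_forall_mem_of_support_subset P₀ hsupp] with ω hω x
    exact abs_le_max_abs_abs (hω x).1 (hω x).2
  have hpow : ∀ᵐ ω ∂(law X P₀), ∀ k : ℕ,
      hamiltonianMoment H p k x₀ ω =
        ∫ t, t ^ k ∂(spectralMeasure (hamiltonian H p ω) (lp.single 2 x₀ (1 : ℂ))) := by
    filter_upwards [hae] with ω hω k
    exact (integral_pow_spectralMeasure_hamiltonian H hp hsum ⟨C, hω⟩ x₀ k).symm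
  have hμ : ∀ᵐ ω ∂(law X P₀),
      IsProbabilityMeasure (spectralMeasure (hamiltonian H p ω) (lp.single 2 x₀ (1 : ℂ))) ∧
      ∀ᵐ t ∂(spectralMeasure (hamiltonian H p ω) (lp.single 2 x₀ (1 : ℂ))),
        t ∈ Set.Icc (-(1 + C)) (1 + C) := by
    filter_upwards [hae] with ω hω
    refine ⟨isProbabilityMeasure_spectralMeasure
      (isSelfAdjoint_hamiltonian H hp hsum ⟨C, hω⟩) ?_,
      ae_spectralMeasure_mem_Icc _ (norm_hamiltonian_le H hp hsum hC hω)⟩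
    rw [lp.norm_single (by norm_num)]
    simp
  have hmeas : ∀ k : ℕ, AEStronglyMeasurable (fun ω => ∫ t, t ^ k
      ∂(spectralMeasure (hamiltonian H p ω) (lp.single 2 x₀ (1 : ℂ)))) (law X P₀) := fun k =>
    (aestronglyMeasurable_hamiltonianMoment H hp hsum P₀ hC hae k x₀).congr
      (hpow.mono fun ω hω => hω k)
  have hgood := hae.and (ae_tendsto_average_eigenvalues_pow H hp hsum P₀ hC hae x₀ b)
  -- The exceptional set is enlarged to a measurable null set, whose complement serves as the event.
  -- It depends on neither `E` nor `k`.
  obtain ⟨S, hSae, hSmeas, hS⟩ := exists_measurable_superset_of_null (ae_iff.1 hgood)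
  refine ⟨Sᶜ, hSmeas.compl, (prob_compl_eq_one_iff hSmeas).2 hS, fun ω hω E hE => ?_⟩
  obtain ⟨hωC, hωm⟩ := not_not.1 fun h => hω (hSae h)
  -- The counting function is by definition the eigenvalue average of the indicator of `]-∞, E]`.
  refine tendsto_cdf_of_tendsto_moments hμ hmeas (Λ := eigenvalueAverage H p x₀ b ω)
    (eigenvalueAverage_one H x₀ b ω) (eigenvalueAverage_mono H hp hsum hC hωC x₀ b)
    (fun k => ?_) hE
  have hk : ∫ ω, hamiltonianMoment H p k x₀ ω ∂(law X P₀) = ∫ ω, ∫ t, t ^ k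
      ∂(spectralMeasure (hamiltonian H p ω) (lp.single 2 x₀ (1 : ℂ))) ∂(law X P₀) :=
    integral_congr_ae (hpow.mono fun ω hω => hω k)
  exact hk ▸ hωm k
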